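/- **Definitions.** For $x\in\{0,1\}^n$ write $\mathrm{support}(x)=\{i:x_i=1\}$ and let $\|x\|_0$ be the size of the support. For $1\le k\le n$, in the problem $\mathbf{UR}_k^{\subset}$ Alice receives $x\in\{0,1\}^n$ and Bob receives $y\in\{0,1\}^n$ together with the number $\|x\|_0$, with the promise that $\mathrm{support}(y)\subsetneq\mathrm{support}(x)$; Bob must output $\min\{k,\|x-y\|_0\}$ distinct indices $i\in[n]$ with $x_i\ne y_i$. Let $\mathbf{R}^{\to,pub}_\delta(\mathbf{UR}_k^{\subset})$ be its randomized one-way communication complexity in the public-coin model with failure probability $\delta$: the least $s$ for which there is a protocol in which Alice sends Bob a single $s$-bit message (both players seeing a common random string) and, for every pair of inputs satisfying the promise, Bob's output is correct with probability at least $1-\delta$. Put $t=\max\{k,\log_2(1/\delta)\}$ and $$F(n,t)=\begin{cases}\min\{n,\;t\log_2^2(n/t)\} & \text{if } t\le n/2,\\ n & \text{if } t>n/2.\end{cases}$$ **Theorem.** For $\delta$ bounded away from $1$ and $1\le k\le n$, $\mathbf{R}^{\to,pub}_\delta(\mathbf{UR}_k^{\subset})=\Theta(F(n,t))$ as $n\to\infty$,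 uniformly in $k$ and $\delta$. Precisely: for every $\varepsilon>0$ there are constants $c,C>0$ and $n_0\in\mathbb{N}$, depending only on $\varepsilon$, such that for all integers $1\le k\le n$ and all real $0<\delta\le 1-\varepsilon$, $$\mathbf{R}^{\to,pub}_\delta(\mathbf{UR}_k^{\subset})\le C\,F(n,t),\qquad\text{and, if } n\ge n_0,\qquad c\,F(n,t)\le \mathbf{R}^{\to,pub}_\delta(\mathbf{UR}_k^{\subset}).$$ -/

import Mathlib

/-- A two-party one-way search problem: Alice holds an element of `AliceInput`, Bob holds an element
of `BobInput`, the pair is promised to satisfy `promise`, and Bob has to produce an answer that is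
`correct` for the pair of inputs. -/
structure OneWayProblem where
  AliceInput : Type
  BobInput : Type
  Answer : Type
  promise : AliceInput → BobInput → Prop
  correct : AliceInput → BobInput → Answer → Prop

/-- A one-way public-coin protocol in which Alice's single message has `s` bits. The public random
string is drawn from `coinDist`, and both players see it. -/
structure PublicCoinProtocol (P : OneWayProblem) (s : ℕ) where
  Coins : Type
  coinDist : PMF Coins
  alice : Coins → P.AliceInput → (Fin s → Bool)
  bob : Coins → (Fin s → Bool) → P.BobInput → P.Answer

/-- The probability, over the public coins, that Bob's answer on the inputs `x`, `y` is wrong. -/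
noncomputable def PublicCoinProtocol.failureProb {P : OneWayProblem} {s : ℕ}
    (π : PublicCoinProtocol P s) (x : P.AliceInput) (y : P.BobInput) : ENNReal :=
  π.coinDist.toOuterMeasure {r | ¬ P.correct x y (π.bob r (π.alice r x) y)}

/-- The protocol has failure probability at most `δ` on every pair of inputs within the promise. -/
def PublicCoinProtocol.Solves {P : OneWayProblem} {s : ℕ}
    (π : PublicCoinProtocol P s) (δ : ℝ) : Prop :=
  ∀ x y, P.promise x y → π.failureProb x y ≤ ENNReal.ofReal δ

/-- Randomized one-way public-coin communication complexity with failure probability `δ`: the least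
number of bits of Alice's message in a protocol with failure probability at most `δ`. -/
noncomputable def oneWayPubComplexity (δ : ℝ) (P : OneWayProblem) : ℕ :=
  sInf {s : ℕ | ∃ π : PublicCoinProtocol P s, π.Solves δ}

/-- The support of a vector in `{0,1}^n`. -/
def bitSupport {n : ℕ} (x : Fin n → Bool) : Finset (Fin n) :=
  Finset.univ.filter fun i => x i = true

/-- The set of coordinates on which two vectors in `{0,1}^n` differ. -/
def diffSet {n : ℕ} (x y : Fin n → Bool) : Finset (Fin n) :=
  Finset.univ.filter fun i => x i ≠ y i

/-- The universal relation problem with promise. Alice gets `x ∈ {0,1}^n`; Bob gets `y ∈ {0,1}^n`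
and the number `w` of ones of `x`; the support of `y` is a proper subset of the support of `x`.
Bob has to output `min k ‖x - y‖₀` distinct coordinates on which `x` and `y` differ. -/
def URSubset (n k : ℕ) : OneWayProblem where
  AliceInput := Fin n → Bool
  BobInput := (Fin n → Bool) × ℕ
  Answer := Finset (Fin n)
  promise x yw := bitSupport yw.1 ⊂ bitSupport x ∧ yw.2 = (bitSupport x).card
  correct x yw B := B ⊆ diffSet x yw.1 ∧ B.card = min k (diffSet x yw.1).card

/-- The set over which the infimum in the communication complexity of `URSubset` is taken is not
empty: Alice may send the whole of `x`. -/
theorem exists_protocol_URSubset (n k : ℕ) {δ : ℝ} :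
    ∃ π : PublicCoinProtocol (URSubset n k) n, π.Solves δ := by
  have h : ∀ x y : Fin n → Bool, ∃ B : Finset (Fin n),
      B ⊆ diffSet x y ∧ B.card = min k (diffSet x y).card := fun x y =>
    Finset.exists_subset_card_eq (min_le_right _ _)
  choose f hf using h
  refine ⟨⟨Unit, PMF.pure (), fun _ x => x, fun _ m yw => f m yw.1⟩, ?_⟩
  intro x y _
  have hc : (URSubset n k).correct x y (f x y.1) := hf x y.1
  simp [PublicCoinProtocol.failureProb, hc]

/-- The rate `min {n, t log² (n/t)}` for `t ≤ n/2`, and `n` for `t > n/2` (where the expression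
`t log² (n/t)` degenerates: it vanishes at `t = n`). -/
noncomputable def urRate (n : ℕ) (t : ℝ) : ℝ :=
  if t ≤ (n : ℝ) / 2 then min (n : ℝ) (t * (Real.logb 2 ((n : ℝ) / t)) ^ 2) else (n : ℝ)

/-!
Write `t = max k (log₂ (1 / δ))`.

**Upper bound** (`exists_sampling_protocol`). The public coins supply nested random sets of
coordinates, the `r`-th of density `2 ^ (-r)`, and a random hash function with `O(t log (n / t))`
bits. Alice sends the hash value of the restriction of `x` to each of the `O(log (n / t))` sets.
By the promise, Bob knows the number of differences `‖x‖₀ - ‖y‖₀`, so he can choose a level at which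
about `t` differences are expected to be kept. By Chernoff bounds (`card_few_kept_le`,
`card_many_kept_le`) there are at least `k` and at most `32 t` of them, up to a probability of order
`2 ^ (-t) ≤ δ`, and then the restriction of `x` is, with the same confidence, the only candidate
with the right hash value (`card_collisions_le`).

**Lower bound** (`lower_bound`). A good protocol yields a short description of a random set `S` of
size `m`. Alice's message for `S` is sent along with some elements of `S`. Bob, who knows a part
`S \ A` of `S`, uses it as the input `y`, obtains elements of the unknown part `A`, and continues
with a larger known part. Every element that he finds in this way need not be sent, which saves
`log (n / m)` bits each (`encoding_bound`). Between two rounds, public randomness moves a random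
part of `A` to the known part; this keeps Bob's queries nearly independent of the coins of the
protocol.

* If `t = O(k)`, half of `A` is moved in each round. The queries are then independent of the coins,
  so each of the `Θ(log (n / k))` rounds supplies `Ω(k)` elements on average (`static_bound`).
* If `t = log₂ (1 / δ)` is larger, single elements are found, which are removed from `A` before the
  next query, and `A` is thinned by the factor `p = K / (K + 1)` with `K = ⌊t / 8⌋`, for
  `Θ(K log (n / K))` rounds. The law of `A` after `j` rounds, given the coins, is at most
  `∏ 1 / (1 - p ^ i) ≤ exp (4 K)` times that of a `p ^ j`-random subset of `S`
  (`le_seqAvg_found_adaptive`, `adaptivityLoss_le`), so a failure probability of `2 ^ (-8 K)` is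
  small enough for adaptive queries (`adaptive_bound`).

With `m` of order `√(n t)`, both cases save `Ω(t log² (n / t))` bits.
-/

open Finset

/-! ### Random subsets -/

section Thinning

variable {α : Type*}

/-- `thin p f A` is the expectation of `f B`, where `B ⊆ A` is the random subset that keeps each
element of `A` independently with probability `p`. -/
noncomputable def thin (p : ℝ) (f : Finset α → ℝ) (A : Finset α) : ℝ :=
  ∑ B ∈ A.powerset, p ^ #B * (1 - p) ^ (#A - #B) * f B

theorem thin_empty (p : ℝ) (f : Finset α → ℝ) : thin p f ∅ = f ∅ := by
  simp [thin]

theorem thin_congr {p : ℝ} {f g : Finset α → ℝ} {A : Finset α} (h : ∀ B ⊆ A, f B = g B) :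
    thin p f A = thin p g A :=
  sum_congr rfl fun B hB => by rw [h B (mem_powerset.1 hB)]

theorem thin_mono {p : ℝ} (h0 : 0 ≤ p) (h1 : p ≤ 1) {f g : Finset α → ℝ} {A : Finset α}
    (h : ∀ B ⊆ A, f B ≤ g B) : thin p f A ≤ thin p g A := by
  refine sum_le_sum fun B hB => mul_le_mul_of_nonneg_left (h B (mem_powerset.1 hB)) ?_
  have : 0 ≤ 1 - p := by linarith
  positivity

theorem thin_add (p : ℝ) (f g : Finset α → ℝ) (A : Finset α) :
    thin p (fun B => f B + g B) A = thin p f A + thin p g A := by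
  simp [thin, mul_add, sum_add_distrib]

theorem thin_const_mul (p c : ℝ) (f : Finset α → ℝ) (A : Finset α) :
    thin p (fun B => c * f B) A = c * thin p f A := by
  simp only [thin, mul_sum]
  exact sum_congr rfl fun B _ => by ring

theorem thin_sum {ι : Type*} (s : Finset ι) (p : ℝ) (f : ι → Finset α → ℝ) (A : Finset α) :
    thin p (fun B => ∑ i ∈ s, f i B) A = ∑ i ∈ s, thin p (f i) A := by
  simp only [thin, mul_sum]
  exact sum_comm

/-- The expectation of `F l`, where `l` is a list of `R` independent random subsets of `α`, each
keeping every element of `α` independently with probability `p`. -/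
noncomputable def seqAvg [Fintype α] (p : ℝ) : ℕ → (List (Finset α) → ℝ) → ℝ
  | 0, F => F []
  | R + 1, F => thin p (fun V => seqAvg p R fun l => F (V :: l)) univ

theorem seqAvg_add [Fintype α] (p : ℝ) (R : ℕ) (F G : List (Finset α) → ℝ) :
    seqAvg p R (fun l => F l + G l) = seqAvg p R F + seqAvg p R G := by
  induction R generalizing F G with
  | zero => rfl
  | succ R ih => simp only [seqAvg, ih, thin_add]

theorem seqAvg_sum [Fintype α] {ι : Type*} (s : Finset ι) (p : ℝ) (R : ℕ) (F : ι → List (Finset α) → ℝ) :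
    seqAvg p R (fun l => ∑ i ∈ s, F i l) = ∑ i ∈ s, seqAvg p R (F i) := by
  induction R generalizing F with
  | zero => rfl
  | succ R ih => simp only [seqAvg, ih, thin_sum]

variable [DecidableEq α]

theorem thin_insert (p : ℝ) (f : Finset α → ℝ) {a : α} {A : Finset α} (ha : a ∉ A) :
    thin p f (insert a A) = (1 - p) * thin p f A + p * thin p (fun B => f (insert a B)) A := by
  rw [thin, sum_powerset_insert ha, thin, thin, mul_sum, mul_sum]
  congr 1
  · refine sum_congr rfl fun B hB => ?_
    have hc := card_le_card (mem_powerset.1 hB)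
    rw [card_insert_of_notMem ha, Nat.sub_add_comm hc, pow_succ]
    ring
  · refine sum_congr rfl fun B hB => ?_
    have haB : a ∉ B := fun h => ha (mem_powerset.1 hB h)
    rw [card_insert_of_notMem ha, card_insert_of_notMem haB, Nat.add_sub_add_right, pow_succ]
    ring

theorem thin_const (p c : ℝ) (A : Finset α) : thin p (fun _ => c) A = c := by
  induction A using Finset.induction_on with
  | empty => exact thin_empty _ _
  | insert a A ha ih => rw [thin_insert p _ ha, ih]; ring

theorem thin_thin (p q : ℝ) (f : Finset α → ℝ) (A : Finset α) :
    thin p (thin q f) A = thin (p * q) f A := by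
  induction A using Finset.induction_on generalizing f with
  | empty => simp [thin_empty]
  | insert a A ha ih =>
    have h : thin p (fun B => thin q f (insert a B)) A
        = thin p (fun B => (1 - q) * thin q f B + q * thin q (fun B => f (insert a B)) B) A :=
      thin_congr fun B hB => thin_insert q f fun h => ha (hB h)
    rw [thin_insert p _ ha, h, thin_add, thin_const_mul, thin_const_mul, ih, ih,
      thin_insert _ _ ha]
    ring

theorem thin_one (f : Finset α → ℝ) (A : Finset α) : thin 1 f A = f A := by
  induction A using Finset.induction_on generalizing f with
  | empty => exact thin_empty _ _
  | insert a A ha ih => rw [thin_insert _ _ ha, ih, ih]; ring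

theorem thin_pow_card (p θ : ℝ) (A : Finset α) :
    thin p (fun B => θ ^ #B) A = (1 - p + p * θ) ^ #A := by
  induction A using Finset.induction_on with
  | empty => simp [thin_empty]
  | insert a A ha ih =>
    have h : thin p (fun B => θ ^ #(insert a B)) A = thin p (fun B => θ * θ ^ #B) A :=
      thin_congr fun B hB => by rw [card_insert_of_notMem fun h => ha (hB h), pow_succ']
    rw [thin_insert p _ ha, h, thin_const_mul, ih, card_insert_of_notMem ha, pow_succ]
    ring

theorem thin_card (p : ℝ) (A : Finset α) : thin p (fun B => (#B : ℝ)) A = p * #A := by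
  induction A using Finset.induction_on with
  | empty => simp [thin_empty]
  | insert a A ha ih =>
    have h : thin p (fun B => (#(insert a B) : ℝ)) A = thin p (fun B => (#B : ℝ) + 1) A :=
      thin_congr fun B hB => by
        rw [card_insert_of_notMem fun h => ha (hB h)]; push_cast; rfl
    rw [thin_insert p _ ha, h, thin_add, thin_const, ih, card_insert_of_notMem ha]
    push_cast
    ring

theorem thin_nonneg {p : ℝ} (h0 : 0 ≤ p) (h1 : p ≤ 1) {f : Finset α → ℝ} (hf : ∀ B, 0 ≤ f B)
    (A : Finset α) : 0 ≤ thin p f A := by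
  rw [← thin_const p 0 A]
  exact thin_mono h0 h1 fun B _ => hf B

/-- The element `a` is dropped with probability `1 - p`, and on that event `A` and `A.erase a` have
the same random subset. -/
theorem thin_erase_le {p : ℝ} (h0 : 0 ≤ p) (h1 : p ≤ 1) {f : Finset α → ℝ} (hf : ∀ B, 0 ≤ f B)
    (A : Finset α) (a : α) : (1 - p) * thin p f (A.erase a) ≤ thin p f A := by
  by_cases ha : a ∈ A
  · conv_rhs => rw [← insert_erase ha, thin_insert p f (notMem_erase a A)]
    have := mul_nonneg h0 (thin_nonneg h0 h1 (fun B => hf (insert a B)) (A.erase a))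
    linarith
  · rw [erase_eq_of_notMem ha]
    have := mul_nonneg h0 (thin_nonneg h0 h1 hf A)
    linarith

theorem thin_inter (p : ℝ) (f : Finset α → ℝ) {A U : Finset α} (h : A ⊆ U) :
    thin p (fun V => f (A ∩ V)) U = thin p f A := by
  obtain ⟨C, hC, rfl⟩ : ∃ C, Disjoint C A ∧ U = C ∪ A :=
    ⟨U \ A, sdiff_disjoint, (sdiff_union_of_subset h).symm⟩
  clear h
  induction C using Finset.induction_on with
  | empty =>
    rw [empty_union]
    exact thin_congr fun B hB => by rw [inter_eq_right.2 hB]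
  | insert a C ha ih =>
    rw [disjoint_insert_left] at hC
    have ha' : a ∉ C ∪ A := by simp [ha, hC.1]
    rw [insert_union, thin_insert p _ ha', ih hC.2]
    simp_rw [inter_insert_of_notMem hC.1]
    rw [ih hC.2]
    ring

theorem exists_thin_le {p : ℝ} (h0 : 0 ≤ p) (h1 : p ≤ 1) (f : Finset α → ℝ) (A : Finset α) :
    ∃ V, thin p f A ≤ f V := by
  obtain ⟨V, _, hV⟩ := exists_max_image A.powerset f ⟨∅, empty_mem_powerset A⟩
  refine ⟨V, ?_⟩
  rw [← thin_const p (f V) A]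
  exact thin_mono h0 h1 fun B hB => hV B (mem_powerset.2 hB)

variable [Fintype α]

theorem seqAvg_const (p c : ℝ) (R : ℕ) :
    seqAvg p R (fun _ : List (Finset α) => c) = c := by
  induction R with
  | zero => rfl
  | succ R ih => simp only [seqAvg, ih, thin_const]

theorem exists_seqAvg_le {p : ℝ} (h0 : 0 ≤ p) (h1 : p ≤ 1) (R : ℕ)
    (F : List (Finset α) → ℝ) : ∃ l : List (Finset α), l.length = R ∧ seqAvg p R F ≤ F l := by
  induction R generalizing F with
  | zero => exact ⟨[], rfl, le_rfl⟩
  | succ R ih =>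
    obtain ⟨V, hV⟩ := exists_thin_le h0 h1 (fun V => seqAvg p R fun l => F (V :: l)) univ
    obtain ⟨l, hl, hF⟩ := ih fun l => F (V :: l)
    exact ⟨V :: l, by simp [hl], hV.trans hF⟩

end Thinning

/-! ### Encoding sets with the help of a one-way message -/

section Encoding

variable {α M : Type*} [DecidableEq α]

/-- Bob's answer in a round of the encoding argument, once it has been checked against the true set:
he holds the message `μ` and the known part `S \ A` of the encoded set `S`, and his answer counts
only if it consists of `k` elements of the unknown part `A`; otherwise it is replaced by `∅`. -/
def checkedAnswer (k : ℕ) (b : M → Finset α → Finset α) (μ : M) (S A : Finset α) : Finset α :=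
  if b μ (S \ A) ⊆ A ∧ #(b μ (S \ A)) = k then b μ (S \ A) else ∅

theorem checkedAnswer_subset (k : ℕ) (b : M → Finset α → Finset α) (μ : M) (S A : Finset α) :
    checkedAnswer k b μ S A ⊆ A := by
  unfold checkedAnswer
  split_ifs with h
  · exact h.1
  · exact empty_subset _

theorem card_checkedAnswer_le (k : ℕ) (b : M → Finset α → Finset α) (μ : M) (S A : Finset α) :
    #(checkedAnswer k b μ S A) ≤ k := by
  unfold checkedAnswer
  split_ifs with h
  · exact h.2.le
  · simp

/-- The unknown part of the encoded set after a round: the elements `X B` of the answer `B = g A`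
are taken out, and of the other elements those outside the public set `V` become known. -/
def survivors (X g : Finset α → Finset α) (A V : Finset α) : Finset α :=
  (A \ X (g A)) ∩ V

theorem survivors_subset (X g : Finset α → Finset α) (A V : Finset α) :
    survivors X g A V ⊆ A :=
  inter_subset_left.trans sdiff_subset

/-- The elements that Bob's answers `g A` supply in the course of the rounds with public sets `l`:
those elements of an answer that are no longer unknown after the round. -/
def found (X g : Finset α → Finset α) : List (Finset α) → Finset α → Finset α
  | [], _ => ∅
  | V :: l, A => (g A \ survivors X g A V) ∪ found X g l (survivors X g A V)

/-- The record of the rounds in which Bob's answer was accepted. -/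
def successFlags (X g : Finset α → Finset α) : List (Finset α) → Finset α → List Bool
  | [], _ => []
  | V :: l, A => decide (g A ≠ ∅) :: successFlags X g l (survivors X g A V)

/-- The reconstruction of the encoded set from the message `μ`, the success flags and a set `E` that
contains the elements which are not found; the last argument is the part known so far. -/
def decodeSet (X : Finset α → Finset α) (b : M → Finset α → Finset α) (μ : M) (E : Finset α) :
    List (Finset α) → List Bool → Finset α → Finset α
  | V :: l, c :: cs, y =>
    decodeSet X b μ E l cs
      (y ∪ ((if c then b μ y else ∅) \ V) ∪ X (if c then b μ y else ∅) ∪ (E \ V))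
  | _, _, y => y ∪ E

theorem length_successFlags (X g : Finset α → Finset α) (l : List (Finset α)) (A : Finset α) :
    (successFlags X g l A).length = l.length := by
  induction l generalizing A with
  | nil => rfl
  | cons V l ih => simp [successFlags, ih]

theorem found_subset (X g : Finset α → Finset α) (hg : ∀ A, g A ⊆ A)
    (l : List (Finset α)) (A : Finset α) : found X g l A ⊆ A := by
  induction l generalizing A with
  | nil => exact empty_subset _
  | cons V l ih =>
    exact union_subset (sdiff_subset.trans (hg A)) ((ih _).trans (survivors_subset X g A V))

theorem card_found_cons (X g : Finset α → Finset α) (hg : ∀ A, g A ⊆ A)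
    (V : Finset α) (l : List (Finset α)) (A : Finset α) :
    #(found X g (V :: l) A)
      = #(g A \ survivors X g A V) + #(found X g l (survivors X g A V)) :=
  card_union_of_disjoint (disjoint_of_subset_right (found_subset X g hg l _) sdiff_disjoint)

theorem card_found_le (X g : Finset α → Finset α) (hg : ∀ A, g A ⊆ A) {k : ℕ}
    (hk : ∀ A, #(g A) ≤ k) (l : List (Finset α)) (A : Finset α) :
    #(found X g l A) ≤ k * l.length := by
  induction l generalizing A with
  | nil => simp [found]
  | cons V l ih =>
    rw [card_found_cons X g hg, List.length_cons, mul_add, mul_one, add_comm]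
    exact add_le_add (ih _) ((card_le_card sdiff_subset).trans (hk A))

theorem decodeSet_successFlags (X : Finset α → Finset α) (hX : ∀ B, X B ⊆ B) (k : ℕ)
    (b : M → Finset α → Finset α) (μ : M) {S E : Finset α} (hE : E ⊆ S)
    (l : List (Finset α)) {A : Finset α} (hA : A ⊆ S)
    (h : A \ found X (checkedAnswer k b μ S) l A ⊆ E) :
    decodeSet X b μ E l (successFlags X (checkedAnswer k b μ S) l A) (S \ A) = S := by
  induction l generalizing A with
  | nil =>
    simp only [found, sdiff_empty] at h
    rw [successFlags, decodeSet]
    · refine subset_antisymm (union_subset sdiff_subset hE) fun j hj => ?_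
      by_cases hjA : j ∈ A
      · exact mem_union_right _ (h hjA)
      · exact mem_union_left _ (mem_sdiff.2 ⟨hj, hjA⟩)
    · simp
  | cons V l ih =>
    set g := checkedAnswer k b μ S with hgdef
    have hg : ∀ A, g A ⊆ A := checkedAnswer_subset k b μ S
    have hB : (if decide (g A ≠ ∅) = true then b μ (S \ A) else ∅) = g A := by
      rw [hgdef]
      unfold checkedAnswer
      split_ifs <;> simp_all
    have key : S \ A ∪ (g A \ V) ∪ X (g A) ∪ (E \ V) = S \ survivors X g A V := by
      refine subset_antisymm (fun j hj => ?_) fun j hj => ?_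
      · simp only [survivors, mem_sdiff, mem_union, mem_inter, not_and] at hj ⊢
        rcases hj with ((hj | hj) | hj) | hj
        · exact ⟨hj.1, fun h' => absurd h'.1 hj.2⟩
        · exact ⟨hA (hg A hj.1), fun _ => hj.2⟩
        · exact ⟨hA (hg A (hX _ hj)), fun h' => absurd hj h'.2⟩
        · exact ⟨hE hj.1, fun _ => hj.2⟩
      · have hjV : j ∈ A → j ∉ X (g A) → j ∉ V := fun h1 h2 h3 =>
          (mem_sdiff.1 hj).2 (mem_inter.2 ⟨mem_sdiff.2 ⟨h1, h2⟩, h3⟩)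
        have hjf : j ∉ found X g l (survivors X g A V) := fun h' =>
          (mem_sdiff.1 hj).2 (found_subset X g hg l _ h')
        simp only [mem_union, mem_sdiff]
        by_cases h1 : j ∈ A
        · by_cases h2 : j ∈ X (g A)
          · exact Or.inl (Or.inr h2)
          · by_cases h3 : j ∈ g A
            · exact Or.inl (Or.inl (Or.inr ⟨h3, hjV h1 h2⟩))
            · refine Or.inr ⟨h (mem_sdiff.2 ⟨h1, fun h' => ?_⟩), hjV h1 h2⟩
              rw [found, mem_union, mem_sdiff] at h'
              exact h'.elim (fun h' => h3 h'.1) hjf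
        · exact Or.inl (Or.inl (Or.inl ⟨(mem_sdiff.1 hj).1, h1⟩))
    rw [successFlags, decodeSet, hB, key]
    refine ih ((survivors_subset X g A V).trans hA) fun j hj => h ?_
    rw [mem_sdiff] at hj ⊢
    refine ⟨survivors_subset X g A V hj.1, fun hjf => ?_⟩
    rw [found, mem_union, mem_sdiff] at hjf
    tauto

/-- The sets `S` of size `m` of which `d` elements are found are determined by the message, the
success flags, and `m - d` elements of `S`. -/
theorem card_filter_found_le [Fintype α] [Fintype M] (X : Finset α → Finset α)
    (hX : ∀ B, X B ⊆ B) (k : ℕ) (a : Finset α → M) (b : M → Finset α → Finset α) (m d : ℕ)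
    (l : List (Finset α)) :
    #{S ∈ powersetCard m univ | d ≤ #(found X (checkedAnswer k b (a S) S) l S)}
      ≤ Fintype.card M * 2 ^ l.length * (Fintype.card α).choose (m - d) := by
  classical
  have hE : ∀ S : Finset α, d ≤ #(found X (checkedAnswer k b (a S) S) l S) → #S = m →
      ∃ E, E ⊆ S ∧ #E = m - d ∧ S \ found X (checkedAnswer k b (a S) S) l S ⊆ E := by
    intro S hd hm
    have hsub := found_subset X _ (checkedAnswer_subset k b (a S) S) l S
    obtain ⟨E, h1, h2, h3⟩ := exists_subsuperset_card_eq
      (sdiff_subset : S \ found X (checkedAnswer k b (a S) S) l S ⊆ S) (n := m - d)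
      (by rw [card_sdiff_of_subset hsub]; omega) (by omega)
    exact ⟨E, h2, h3, h1⟩
  choose! E hES hEc hEf using hE
  let T : Finset (M × List.Vector Bool l.length × Finset α) :=
    univ ×ˢ univ ×ˢ powersetCard (m - d) univ
  have hT : #T = Fintype.card M * 2 ^ l.length * (Fintype.card α).choose (m - d) := by
    simp [T, card_product, card_vector, mul_assoc]
  rw [← hT]
  refine card_le_card_of_injOn
    (fun S => (a S, ⟨successFlags X (checkedAnswer k b (a S) S) l S,
      length_successFlags _ _ _ _⟩, E S)) ?_ ?_
  · intro S hS
    simp only [coe_filter, mem_powersetCard, Set.mem_ofPred_eq] at hS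
    refine mem_coe.2 (mem_product.2 ⟨mem_univ _, mem_product.2 ⟨mem_univ _, ?_⟩⟩)
    exact mem_powersetCard.2 ⟨subset_univ _, hEc S hS.2 hS.1.2⟩
  · intro S hS S' hS' heq
    simp only [coe_filter, mem_powersetCard, Set.mem_ofPred_eq] at hS hS'
    have h1 : a S = a S' := congrArg Prod.fst heq
    have h3 : E S = E S' := congrArg (fun z => z.2.2) heq
    have e1 := decodeSet_successFlags X hX k b (a S) (hES S hS.2 hS.1.2) l subset_rfl
      (hEf S hS.2 hS.1.2)
    have e2 := decodeSet_successFlags X hX k b (a S') (hES S' hS'.2 hS'.1.2) l subset_rfl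
      (hEf S' hS'.2 hS'.1.2)
    rw [sdiff_self] at e1 e2
    have h2 : successFlags X (checkedAnswer k b (a S) S) l S
        = successFlags X (checkedAnswer k b (a S') S') l S' := congrArg (fun z => z.2.1.1) heq
    rw [← e1, ← e2, h2, h3, h1]

theorem choose_sub_mul_pow_le (n m d : ℕ) (hd : d ≤ m) (hm : m ≤ n) :
    n.choose (m - d) * (n - m) ^ d ≤ n.choose m * m ^ d := by
  induction d with
  | zero => simp
  | succ d ih =>
    have hstep : n.choose (m - (d + 1)) * (n - m) ≤ n.choose (m - d) * m := by
      obtain ⟨j, hj⟩ : ∃ j, m - d = j + 1 := ⟨m - d - 1, by omega⟩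
      have hj' : m - (d + 1) = j := by omega
      rw [hj, hj']
      calc n.choose j * (n - m) ≤ n.choose j * (n - j) := Nat.mul_le_mul_left _ (by omega)
        _ = n.choose (j + 1) * (j + 1) := (Nat.choose_succ_right_eq n j).symm
        _ ≤ n.choose (j + 1) * m := Nat.mul_le_mul_left _ (by omega)
    calc n.choose (m - (d + 1)) * (n - m) ^ (d + 1)
        = n.choose (m - (d + 1)) * (n - m) * (n - m) ^ d := by ring
      _ ≤ n.choose (m - d) * m * (n - m) ^ d := Nat.mul_le_mul_right _ hstep
      _ = n.choose (m - d) * (n - m) ^ d * m := by ring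
      _ ≤ n.choose m * m ^ d * m := Nat.mul_le_mul_right _ (ih (by omega))
      _ = n.choose m * m ^ (d + 1) := by ring

/-- The encoding bound. If a randomized strategy finds on average a `γ`-fraction of the `k * R`
elements that it could find at best, then its message is long: fixing the coins and the public sets,
a fraction `γ / 2` of all sets of size `m` is encoded by the message, `R` flags, and a set which is
smaller by `d` elements. -/
theorem encoding_bound [Fintype α] [Fintype M] {ι : Type*} [Fintype ι]
    (X : Finset α → Finset α) (hX : ∀ B, X B ⊆ B) {k R m d : ℕ} (hm : m ≤ Fintype.card α)
    (a : ι → Finset α → M) (b : ι → M → Finset α → Finset α) (w : ι → ℝ) (hw0 : ∀ i, 0 ≤ w i)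
    (hw1 : ∑ i, w i = 1) {p γ : ℝ} (h0 : 0 ≤ p) (h1 : p ≤ 1) (hγ : 0 < γ) (hk : 0 < k)
    (hR : 0 < R) (hd : (d : ℝ) ≤ γ / 2 * (k * R))
    (hgain : ∀ S : Finset α, #S = m → γ * (k * R) ≤ ∑ i, w i * seqAvg p R fun l =>
      (#(found X (checkedAnswer k (b i) (a i S) S) l S) : ℝ)) :
    γ / 2 * ((Fintype.card α - m : ℕ) : ℝ) ^ d
      ≤ Fintype.card M * 2 ^ R * (m : ℝ) ^ d := by
  classical
  set n := Fintype.card α with hn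
  set P : Finset (Finset α) := powersetCard m univ with hP
  have hPc : #P = n.choose m := by simp [hP, hn]
  have hkR : (0 : ℝ) < k * R := by positivity
  have hchoose : (0 : ℝ) < n.choose m := by exact_mod_cast Nat.choose_pos hm
  -- Some choice of the strategy's coins and of the public sets is at least as good as the average.
  obtain ⟨i, hi⟩ : ∃ i, γ * (k * R) * n.choose m ≤ seqAvg p R fun l =>
      ∑ S ∈ P, (#(found X (checkedAnswer k (b i) (a i S) S) l S) : ℝ) := by
    by_contra! hcon
    have hsum : γ * (k * R) * n.choose m ≤ ∑ i, w i * seqAvg p R fun l =>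
        ∑ S ∈ P, (#(found X (checkedAnswer k (b i) (a i S) S) l S) : ℝ) := by
      simp_rw [seqAvg_sum, mul_sum]
      rw [sum_comm, ← hPc, mul_comm, ← nsmul_eq_mul]
      exact card_nsmul_le_sum _ _ _ fun S hS => hgain S (mem_powersetCard.1 hS).2
    have hlt : ∑ i, w i * (seqAvg p R fun l =>
        ∑ S ∈ P, (#(found X (checkedAnswer k (b i) (a i S) S) l S) : ℝ))
        < ∑ i, w i * (γ * (k * R) * n.choose m) := by
      refine sum_lt_sum (fun i _ => mul_le_mul_of_nonneg_left (hcon i).le (hw0 i)) ?_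
      obtain ⟨i, hi⟩ : ∃ i, 0 < w i := by
        by_contra! hw
        have := sum_nonpos fun i (_ : i ∈ univ) => hw i
        linarith
      exact ⟨i, mem_univ _, mul_lt_mul_of_pos_left (hcon i) hi⟩
    rw [← sum_mul, hw1, one_mul] at hlt
    linarith
  obtain ⟨l, hl, hle⟩ := exists_seqAvg_le h0 h1 R fun l =>
      ∑ S ∈ P, (#(found X (checkedAnswer k (b i) (a i S) S) l S) : ℝ)
  replace hi := hi.trans hle
  -- Markov's inequality: many sets have at least `d` elements found.
  set G := {S ∈ P | d ≤ #(found X (checkedAnswer k (b i) (a i S) S) l S)} with hG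
  have hupper : ∑ S ∈ P, (#(found X (checkedAnswer k (b i) (a i S) S) l S) : ℝ)
      ≤ #G * (k * R) + n.choose m * d := by
    calc ∑ S ∈ P, (#(found X (checkedAnswer k (b i) (a i S) S) l S) : ℝ)
        ≤ ∑ S ∈ P, ((if d ≤ #(found X (checkedAnswer k (b i) (a i S) S) l S)
            then (k * R : ℝ) else 0) + d) := by
          refine sum_le_sum fun S _ => ?_
          split_ifs with h
          · have := card_found_le X _ (checkedAnswer_subset k (b i) (a i S) S)
              (card_checkedAnswer_le k (b i) (a i S) S) l S
            rw [hl] at this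
            have : (#(found X (checkedAnswer k (b i) (a i S) S) l S) : ℝ) ≤ k * R := by
              exact_mod_cast this
            have : (0 : ℝ) ≤ d := by positivity
            linarith
          · rw [zero_add]
            exact_mod_cast (not_le.1 h).le
      _ = #G * (k * R) + n.choose m * d := by
          rw [sum_add_distrib, ← sum_filter, sum_const, sum_const, hPc, nsmul_eq_mul,
            nsmul_eq_mul]
  have hGcard : γ / 2 * n.choose m ≤ #G := by
    have h3 : (n.choose m : ℝ) * d ≤ n.choose m * (γ / 2 * (k * R)) := by gcongr
    have h4 : γ / 2 * n.choose m * (k * R) ≤ #G * (k * R) := by linarith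
    exact le_of_mul_le_mul_right h4 hkR
  have hGle : #G ≤ Fintype.card M * 2 ^ R * n.choose (m - d) := by
    rw [← hl]
    exact card_filter_found_le X hX k (a i) (b i) m d l
  have hdm : d ≤ m := by
    have hGpos : 0 < #G := by
      have : (0 : ℝ) < #G := lt_of_lt_of_le (by positivity) hGcard
      exact_mod_cast this
    obtain ⟨S, hS⟩ := card_pos.1 hGpos
    rw [hG, mem_filter, hP, mem_powersetCard] at hS
    have := card_le_card (found_subset X _ (checkedAnswer_subset k (b i) (a i S) S) l S)
    omega
  have hratio : (n.choose (m - d) : ℝ) * ((n - m : ℕ) : ℝ) ^ d ≤ n.choose m * (m : ℝ) ^ d := by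
    exact_mod_cast choose_sub_mul_pow_le n m d hdm hm
  have hfin : γ / 2 * ((n - m : ℕ) : ℝ) ^ d * n.choose m
      ≤ Fintype.card M * 2 ^ R * (m : ℝ) ^ d * n.choose m := by
    calc γ / 2 * ((n - m : ℕ) : ℝ) ^ d * n.choose m
        = γ / 2 * n.choose m * ((n - m : ℕ) : ℝ) ^ d := by ring
      _ ≤ #G * ((n - m : ℕ) : ℝ) ^ d := by gcongr
      _ ≤ (Fintype.card M * 2 ^ R * n.choose (m - d)) * ((n - m : ℕ) : ℝ) ^ d := by
          gcongr
          exact_mod_cast hGle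
      _ = Fintype.card M * 2 ^ R * (n.choose (m - d) * ((n - m : ℕ) : ℝ) ^ d) := by ring
      _ ≤ Fintype.card M * 2 ^ R * (n.choose m * (m : ℝ) ^ d) := by gcongr
      _ = Fintype.card M * 2 ^ R * (m : ℝ) ^ d * n.choose m := by ring
  exact le_of_mul_le_mul_right hfin hchoose

end Encoding

/-! ### Expected number of elements found -/

section ExpectedGain

variable {α : Type*} [DecidableEq α] [Fintype α]

/-- Without removal of the answers, the `j`-th unknown part is a `p ^ j`-random subset, and each
element of the answer becomes known in its round with probability `1 - p`. -/
theorem seqAvg_found_static (p : ℝ) (g : Finset α → Finset α) (hg : ∀ A, g A ⊆ A) (R : ℕ)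
    (A : Finset α) :
    seqAvg p R (fun l => (#(found (fun _ => ∅) g l A) : ℝ))
      = ∑ j ∈ range R, (1 - p) * thin (p ^ j) (fun B => (#(g B) : ℝ)) A := by
  induction R generalizing A with
  | zero => simp [seqAvg, found]
  | succ R ih =>
    have hV : ∀ V, seqAvg p R (fun l => (#(found (fun _ => ∅) g (V :: l) A) : ℝ))
        = #(g A) + ((-1) * (#(g A ∩ V) : ℝ)
          + seqAvg p R fun l => (#(found (fun _ => ∅) g l (A ∩ V)) : ℝ)) := by
      intro V
      simp_rw [card_found_cons _ g hg]
      push_cast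
      rw [seqAvg_add, seqAvg_const]
      simp only [survivors, sdiff_empty]
      have h1 : g A \ (A ∩ V) = g A \ V := by
        ext j
        have := @hg A j
        simp only [mem_sdiff, mem_inter]
        tauto
      have h2 : (#(g A \ V) : ℝ) + #(g A ∩ V) = #(g A) := by
        exact_mod_cast card_sdiff_add_card_inter (g A) V
      rw [h1]
      linarith
    rw [seqAvg]
    simp_rw [hV, ih]
    rw [thin_add, thin_add, thin_const, thin_const_mul,
      thin_inter p (fun B => (#B : ℝ)) (subset_univ (g A)), thin_card,
      thin_inter p (fun B => ∑ j ∈ range R, (1 - p) * thin (p ^ j) (fun B => (#(g B) : ℝ)) B)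
        (subset_univ A), thin_sum, sum_range_succ', pow_zero, thin_one]
    simp_rw [thin_const_mul, thin_thin, ← pow_succ']
    ring

/-- The factor by which the law of the unknown part after `j` adaptive rounds may exceed the law
of a `p ^ j`-random subset. -/
noncomputable def adaptivityLoss (p : ℝ) (j : ℕ) : ℝ :=
  ∏ i ∈ range j, (1 - p ^ (i + 1))⁻¹

theorem adaptivityLoss_nonneg {p : ℝ} (h0 : 0 ≤ p) (h1 : p ≤ 1) (j : ℕ) :
    0 ≤ adaptivityLoss p j := by
  refine prod_nonneg fun i _ => inv_nonneg.2 ?_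
  linarith [pow_le_one₀ (n := i + 1) h0 h1]

/-- With removal of the answers, the unknown part depends on Bob's earlier answers, hence on the
coins of the protocol. Its law given the coins is nevertheless dominated by a multiple of the law
of a `p ^ j`-random subset: an element that is removed at once would have been dropped within `i`
rounds with probability `1 - p ^ i` anyway. -/
theorem le_seqAvg_found_adaptive {p : ℝ} (h0 : 0 ≤ p) (h1 : p < 1) (g : Finset α → Finset α)
    (hg : ∀ A, g A ⊆ A) (hg1 : ∀ A, #(g A) ≤ 1) (R : ℕ) (A : Finset α) :
    R - ∑ j ∈ range R, adaptivityLoss p j * thin (p ^ j) (fun B => 1 - (#(g B) : ℝ)) A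
      ≤ seqAvg p R (fun l => (#(found (fun B => B) g l A) : ℝ)) := by
  have hbad : ∀ B, 0 ≤ 1 - (#(g B) : ℝ) := fun B => by
    have : (#(g B) : ℝ) ≤ 1 := by exact_mod_cast hg1 B
    linarith
  induction R generalizing A with
  | zero => simp [seqAvg, found]
  | succ R ih =>
    have hV : ∀ V, seqAvg p R (fun l => (#(found (fun B => B) g (V :: l) A) : ℝ))
        = #(g A) + seqAvg p R fun l => (#(found (fun B => B) g l ((A \ g A) ∩ V)) : ℝ) := by
      intro V
      simp_rw [card_found_cons _ g hg]
      push_cast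
      rw [seqAvg_add, seqAvg_const]
      simp only [survivors]
      have h1 : g A \ ((A \ g A) ∩ V) = g A := by
        ext j
        simp only [mem_sdiff, mem_inter]
        tauto
      rw [h1]
    rw [seqAvg]
    simp_rw [hV]
    rw [thin_add, thin_const, thin_inter p
      (fun B => seqAvg p R fun l => (#(found (fun B => B) g l B) : ℝ)) (subset_univ (A \ g A))]
    have hstep : ∀ j, (1 - p ^ (j + 1)) * thin (p ^ (j + 1)) (fun B => 1 - (#(g B) : ℝ)) (A \ g A)
        ≤ thin (p ^ (j + 1)) (fun B => 1 - (#(g B) : ℝ)) A := by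
      intro j
      have hp0 : 0 ≤ p ^ (j + 1) := pow_nonneg h0 _
      have hp1 : p ^ (j + 1) ≤ 1 := pow_le_one₀ h0 h1.le
      rcases Nat.le_one_iff_eq_zero_or_eq_one.1 (hg1 A) with h | h
      · rw [card_eq_zero.1 h, sdiff_empty]
        have := mul_nonneg hp0 (thin_nonneg hp0 hp1 hbad A)
        linarith
      · obtain ⟨a, ha⟩ := card_eq_one.1 h
        rw [ha, sdiff_singleton_eq_erase]
        exact thin_erase_le hp0 hp1 hbad A a
    have hmono := thin_mono h0 h1.le fun B (_ : B ⊆ A \ g A) => ih B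
    refine le_trans ?_ (add_le_add_right hmono _)
    have hneg : thin p (fun B => (R : ℝ) - ∑ j ∈ range R,
        adaptivityLoss p j * thin (p ^ j) (fun B => 1 - (#(g B) : ℝ)) B) (A \ g A)
        = R - ∑ j ∈ range R, adaptivityLoss p j *
          thin (p ^ (j + 1)) (fun B => 1 - (#(g B) : ℝ)) (A \ g A) := by
      simp_rw [sub_eq_add_neg (R : ℝ), neg_eq_neg_one_mul (∑ j ∈ range R, _)]
      rw [thin_add, thin_const, thin_const_mul, thin_sum]
      simp_rw [thin_const_mul, thin_thin, ← pow_succ']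
    rw [hneg, sum_range_succ', pow_zero, thin_one]
    have hsum : ∑ j ∈ range R, adaptivityLoss p j *
          thin (p ^ (j + 1)) (fun B => 1 - (#(g B) : ℝ)) (A \ g A)
        ≤ ∑ j ∈ range R, adaptivityLoss p (j + 1) *
          thin (p ^ (j + 1)) (fun B => 1 - (#(g B) : ℝ)) A := by
      refine sum_le_sum fun j _ => ?_
      have hlt : 0 < 1 - p ^ (j + 1) := by
        have : p ^ (j + 1) < 1 := pow_lt_one₀ h0 h1 (Nat.succ_ne_zero j)
        linarith
      rw [adaptivityLoss, adaptivityLoss, prod_range_succ, mul_assoc]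
      refine mul_le_mul_of_nonneg_left ?_ (adaptivityLoss_nonneg h0 h1.le j)
      rw [inv_mul_eq_div, le_div_iff₀ hlt, mul_comm]
      exact hstep j
    have h00 : adaptivityLoss p 0 = 1 := by simp [adaptivityLoss]
    rw [h00]
    push_cast
    linarith

end ExpectedGain

section AdaptivityLoss

theorem one_add_pow_quadratic_le {x : ℝ} (hx : 0 ≤ x) (j : ℕ) :
    1 + j * x + j * (j - 1) / 2 * x ^ 2 ≤ (1 + x) ^ j := by
  induction j with
  | zero => simp
  | succ j ih =>
    have h2 := mul_le_mul_of_nonneg_right ih (by linarith : 0 ≤ 1 + x)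
    rw [pow_succ]
    refine le_trans ?_ h2
    have h3 : 0 ≤ (j : ℝ) * (j - 1) * x ^ 3 := by
      rcases Nat.eq_zero_or_pos j with rfl | hj
      · simp
      · have : (1 : ℝ) ≤ j := by exact_mod_cast hj
        have : (0 : ℝ) ≤ (j : ℝ) - 1 := by linarith
        positivity
    push_cast
    nlinarith

theorem inv_one_sub_inv_pow {x : ℝ} (hx : 0 < x) (j : ℕ) :
    (1 - ((1 + x)⁻¹) ^ (j + 1))⁻¹ = 1 + ((1 + x) ^ (j + 1) - 1)⁻¹ := by
  have h1 : 1 < (1 + x) ^ (j + 1) := one_lt_pow₀ (by linarith) (Nat.succ_ne_zero j)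
  have h2 : (1 + x) ^ (j + 1) - 1 ≠ 0 := by linarith
  rw [inv_pow]
  set y := (1 + x) ^ (j + 1)
  have h3 : y ≠ 0 := by linarith
  have h4 : 1 - y⁻¹ = (y - 1) / y := by field_simp
  rw [h4, inv_div]
  field_simp
  ring

/-- For `p = (1 + 1 / K)⁻¹` the first `K` factors of the loss contribute at most
`(2 K) ^ K / K ! ≤ exp (2 K)`. -/
theorem adaptivityLoss_le_of_le {K : ℕ} (hK : 0 < K) {j : ℕ} (hj : j ≤ K) :
    adaptivityLoss ((1 + (K : ℝ)⁻¹)⁻¹) j ≤ (2 * K) ^ j / j.factorial := by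
  have hK0 : (0 : ℝ) < K := by exact_mod_cast hK
  induction j with
  | zero => simp [adaptivityLoss]
  | succ j ih =>
    have hrec : adaptivityLoss ((1 + (K : ℝ)⁻¹)⁻¹) (j + 1)
        = adaptivityLoss ((1 + (K : ℝ)⁻¹)⁻¹) j * (1 - ((1 + (K : ℝ)⁻¹)⁻¹) ^ (j + 1))⁻¹ := by
      rw [adaptivityLoss, prod_range_succ, adaptivityLoss]
    rw [hrec, inv_one_sub_inv_pow (by positivity)]
    have hb : 1 + ((j + 1 : ℕ) : ℝ) * (K : ℝ)⁻¹ ≤ (1 + (K : ℝ)⁻¹) ^ (j + 1) :=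
      one_add_mul_le_pow (by have : (0 : ℝ) ≤ (K : ℝ)⁻¹ := by positivity
                             linarith) _
    have hj1 : ((j : ℝ) + 1) ≤ K := by exact_mod_cast hj
    have hf : 1 + ((1 + (K : ℝ)⁻¹) ^ (j + 1) - 1)⁻¹ ≤ 2 * K / (j + 1) := by
      have h1 : ((1 + (K : ℝ)⁻¹) ^ (j + 1) - 1)⁻¹ ≤ (((j : ℝ) + 1) * (K : ℝ)⁻¹)⁻¹ := by
        apply inv_anti₀ (by positivity)
        push_cast at hb
        linarith
      have h2 : (((j : ℝ) + 1) * (K : ℝ)⁻¹)⁻¹ = K / (j + 1) := by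
        rw [mul_inv, inv_inv]; ring
      have h3 : (1 : ℝ) ≤ K / (j + 1) := by
        rw [le_div_iff₀ (by positivity)]; linarith
      rw [h2] at h1
      have h4 : (2 : ℝ) * K / (j + 1) = K / (j + 1) + K / (j + 1) := by ring
      linarith
    calc _ ≤ (2 * (K : ℝ)) ^ j / j.factorial * (2 * (K : ℝ) / (j + 1)) := by
          refine mul_le_mul (ih (by omega)) hf ?_ (by positivity)
          have : (0 : ℝ) ≤ ((j + 1 : ℕ) : ℝ) * (K : ℝ)⁻¹ := by positivity
          have : 0 ≤ ((1 + (K : ℝ)⁻¹) ^ (j + 1) - 1)⁻¹ := inv_nonneg.2 (by linarith)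
          linarith
      _ = _ := by
          rw [Nat.factorial_succ, pow_succ]
          push_cast
          field_simp

/-- The factors of the loss beyond the first `K` ones are controlled by the quadratic growth of
`p ^ (-j)`; the resulting sum `∑ 2 K² / (j (j - 1))` telescopes. -/
theorem adaptivityLoss_le_of_ge {K : ℕ} (hK : 0 < K) {j : ℕ} (hj : K ≤ j) :
    adaptivityLoss ((1 + (K : ℝ)⁻¹)⁻¹) j ≤ Real.exp (4 * K - 2 * K ^ 2 / j) := by
  have hK0 : (0 : ℝ) < K := by exact_mod_cast hK
  induction j, hj using Nat.le_induction with
  | base =>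
    refine (adaptivityLoss_le_of_le hK le_rfl).trans ?_
    refine (Real.pow_div_factorial_le_exp (2 * K) (by positivity) K).trans
      (Real.exp_le_exp.2 (le_of_eq ?_))
    field_simp
    ring
  | succ j hj ih =>
    have hj0 : (0 : ℝ) < j := by exact_mod_cast hK.trans_le hj
    have hrec : adaptivityLoss ((1 + (K : ℝ)⁻¹)⁻¹) (j + 1)
        = adaptivityLoss ((1 + (K : ℝ)⁻¹)⁻¹) j * (1 - ((1 + (K : ℝ)⁻¹)⁻¹) ^ (j + 1))⁻¹ := by
      rw [adaptivityLoss, prod_range_succ, adaptivityLoss]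
    rw [hrec, inv_one_sub_inv_pow (by positivity)]
    have hb := one_add_pow_quadratic_le (by positivity : (0 : ℝ) ≤ (K : ℝ)⁻¹) (j + 1)
    push_cast at hb
    have hb' : (j : ℝ) * (j + 1) / (2 * K ^ 2) ≤ (1 + (K : ℝ)⁻¹) ^ (j + 1) - 1 := by
      have e : ((j : ℝ) + 1) * (j + 1 - 1) / 2 * (K : ℝ)⁻¹ ^ 2 = j * (j + 1) / (2 * K ^ 2) := by
        field_simp
        ring
      have : (0 : ℝ) ≤ ((j : ℝ) + 1) * (K : ℝ)⁻¹ := by positivity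
      linarith
    have hf : 1 + ((1 + (K : ℝ)⁻¹) ^ (j + 1) - 1)⁻¹
        ≤ Real.exp (2 * K ^ 2 / j - 2 * K ^ 2 / (j + 1)) := by
      have h1 : ((1 + (K : ℝ)⁻¹) ^ (j + 1) - 1)⁻¹ ≤ ((j : ℝ) * (j + 1) / (2 * K ^ 2))⁻¹ :=
        inv_anti₀ (by positivity) hb'
      have h2 : ((j : ℝ) * (j + 1) / (2 * K ^ 2))⁻¹
          = 2 * (K : ℝ) ^ 2 / j - 2 * (K : ℝ) ^ 2 / (j + 1) := by
        field_simp
        ring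
      rw [h2] at h1
      linarith [Real.add_one_le_exp (2 * (K : ℝ) ^ 2 / j - 2 * K ^ 2 / (j + 1))]
    calc _ ≤ Real.exp (4 * K - 2 * K ^ 2 / j)
          * Real.exp (2 * K ^ 2 / j - 2 * K ^ 2 / (j + 1)) := by
          refine mul_le_mul ih hf ?_ (Real.exp_pos _).le
          have : (0 : ℝ) ≤ (j : ℝ) * (j + 1) / (2 * K ^ 2) := by positivity
          have : 0 ≤ ((1 + (K : ℝ)⁻¹) ^ (j + 1) - 1)⁻¹ := inv_nonneg.2 (by linarith)
          linarith
      _ = _ := by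
          rw [← Real.exp_add]
          congr 1
          push_cast
          ring

theorem adaptivityLoss_le {K : ℕ} (hK : 0 < K) (j : ℕ) :
    adaptivityLoss ((1 + (K : ℝ)⁻¹)⁻¹) j ≤ Real.exp (4 * K) := by
  have hK0 : (0 : ℝ) < K := by exact_mod_cast hK
  rcases le_total j K with hj | hj
  · refine (adaptivityLoss_le_of_le hK hj).trans ?_
    refine (Real.pow_div_factorial_le_exp (2 * K) (by positivity) j).trans
      (Real.exp_le_exp.2 ?_)
    linarith
  · refine (adaptivityLoss_le_of_ge hK hj).trans (Real.exp_le_exp.2 ?_)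
    have : (0 : ℝ) ≤ 2 * K ^ 2 / j := by positivity
    linarith

end AdaptivityLoss

/-! ### Message length of finite strategies -/

section StrategyBounds

variable {α M ι : Type*} [DecidableEq α] [Fintype α] [Fintype M] [Fintype ι]

theorem scale_mul_le_sub {k q n : ℕ} (hq : 0 < q) (hn : k * 16 ^ q ≤ n) :
    k * 4 ^ q * 2 ^ q ≤ n - k * 4 ^ q := by
  apply Nat.le_sub_of_add_le
  refine le_trans ?_ hn
  have e : (16 : ℕ) ^ q = 4 ^ q * (2 ^ q * 2 ^ q) := by
    rw [← mul_pow, ← mul_pow]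
    norm_num
  have h2 : 2 ^ q + 1 ≤ 2 ^ q * 2 ^ q := by
    have : 2 ≤ 2 ^ q := Nat.le_self_pow hq.ne' 2
    nlinarith
  calc k * 4 ^ q * 2 ^ q + k * 4 ^ q = k * 4 ^ q * (2 ^ q + 1) := by ring
    _ ≤ k * 4 ^ q * (2 ^ q * 2 ^ q) := Nat.mul_le_mul_left _ h2
    _ = k * 16 ^ q := by rw [e]; ring

theorem exponent_le_of_encoding_bound {s R u q d m N : ℕ} {c : ℝ} (hm : 0 < m)
    (hN : m * 2 ^ q ≤ N) (hc : 1 / 2 ^ u ≤ c)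
    (h : c * (N : ℝ) ^ d ≤ (2 ^ s : ℕ) * 2 ^ R * (m : ℝ) ^ d) : q * d ≤ s + R + u := by
  have hc0 : 0 ≤ c := le_trans (by positivity) hc
  have hmpos : (0 : ℝ) < (m : ℝ) ^ d := by positivity
  have hN' : (m : ℝ) * 2 ^ q ≤ N := by exact_mod_cast hN
  have h1 : (1 : ℝ) / 2 ^ u * ((m : ℝ) * 2 ^ q) ^ d ≤ (2 ^ s : ℕ) * 2 ^ R * (m : ℝ) ^ d := by
    refine le_trans ?_ h
    gcongr
  rw [mul_pow, ← pow_mul] at h1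
  have h2 : (2 : ℝ) ^ (q * d) * (m : ℝ) ^ d ≤ 2 ^ (s + R + u) * (m : ℝ) ^ d := by
    calc (2 : ℝ) ^ (q * d) * (m : ℝ) ^ d
        = 2 ^ u * (1 / 2 ^ u * ((m : ℝ) ^ d * 2 ^ (q * d))) := by field_simp
      _ ≤ 2 ^ u * ((2 ^ s : ℕ) * 2 ^ R * (m : ℝ) ^ d) := by gcongr
      _ = 2 ^ (s + R + u) * (m : ℝ) ^ d := by push_cast; ring
  exact (pow_le_pow_iff_right₀ (by norm_num : (1 : ℝ) < 2)).1 (le_of_mul_le_mul_right h2 hmpos)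

/-- If each round succeeds with probability at least `ε`, halving the unknown part `q` times without
any adaptivity shows that finding `k` elements at a time takes a message of `Ω(k q²)` bits. -/
theorem static_bound {s k q : ℕ} {ε : ℝ} (hM : Fintype.card M = 2 ^ s) (hk : 0 < k) (hε : 0 < ε)
    (hε1 : ε ≤ 1) (hq : 48 / ε ≤ q) (hn : k * 16 ^ q ≤ Fintype.card α)
    (a : ι → Finset α → M) (b : ι → M → Finset α → Finset α) (w : ι → ℝ) (hw0 : ∀ i, 0 ≤ w i)
    (hw1 : ∑ i, w i = 1)
    (hsucc : ∀ S A : Finset α, #S = k * 4 ^ q → A ⊆ S → k ≤ #A →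
      ε * k ≤ ∑ i, w i * #(checkedAnswer k (b i) (a i S) S A)) :
    ε * k * q ^ 2 / 16 ≤ s := by
  have hq48 : (48 : ℝ) ≤ q := by
    refine le_trans ?_ hq
    rw [le_div_iff₀ hε]
    linarith
  have hq0 : 0 < q := by
    have : (0 : ℝ) < q := by linarith
    exact_mod_cast this
  have hεq : 48 ≤ ε * q := by rwa [div_le_iff₀' hε] at hq
  have hk1 : (1 : ℝ) ≤ k := by exact_mod_cast hk
  have hm : k * 4 ^ q ≤ Fintype.card α :=
    le_trans (Nat.mul_le_mul_left _ (Nat.pow_le_pow_left (by norm_num) q)) hn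
  have h2q : (q : ℝ) + 1 ≤ 2 ^ q := by exact_mod_cast Nat.lt_two_pow_self
  -- In each of the rounds, fewer than `k` elements are left with probability at most `ε / 2`.
  have htail : ∀ j ∈ range q, (2 : ℝ) ^ k * (1 - (1 / 2) ^ j + (1 / 2) ^ j * (1 / 2)) ^ (k * 4 ^ q)
      ≤ ε / 2 := by
    intro j hj
    rw [mem_range] at hj
    set x : ℝ := (1 / 2) ^ j / 2 with hx
    have hx0 : 0 < x := by positivity
    have hx1 : x ≤ 1 := by
      have : ((1 : ℝ) / 2) ^ j ≤ 1 := pow_le_one₀ (by norm_num) (by norm_num)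
      rw [hx]; linarith
    have hxq : (1 / 2 : ℝ) ^ q ≤ x := by
      rw [hx, show ((1 : ℝ) / 2) ^ j / 2 = (1 / 2) ^ (j + 1) by ring]
      exact pow_le_pow_of_le_one (by norm_num) (by norm_num) hj
    have hmx : (k : ℝ) * 2 ^ q ≤ x * (k * 4 ^ q) := by
      have h4 : (4 : ℝ) ^ q * (1 / 2) ^ q = 2 ^ q := by rw [← mul_pow]; norm_num
      calc (k : ℝ) * 2 ^ q = (1 / 2 : ℝ) ^ q * (k * 4 ^ q) := by rw [← h4]; ring
        _ ≤ x * (k * 4 ^ q) := by gcongr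
    have e1 : 1 - (1 / 2 : ℝ) ^ j + (1 / 2) ^ j * (1 / 2) = 1 - x := by rw [hx]; ring
    rw [e1]
    have e2 : (1 - x) ^ (k * 4 ^ q) ≤ Real.exp (-(k * 2 ^ q)) := by
      calc (1 - x) ^ (k * 4 ^ q) ≤ Real.exp (-x) ^ (k * 4 ^ q) :=
            pow_le_pow_left₀ (by linarith) (by linarith [Real.add_one_le_exp (-x)]) _
        _ = Real.exp (-(x * (k * 4 ^ q))) := by
            rw [← Real.exp_nat_mul]; congr 1; push_cast; ring
        _ ≤ _ := Real.exp_le_exp.2 (by linarith)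
    have e3 : (2 : ℝ) ^ k ≤ Real.exp k := by
      rw [← Real.exp_one_pow]
      exact pow_le_pow_left₀ (by norm_num) (by linarith [Real.add_one_le_exp (1 : ℝ)]) _
    calc (2 : ℝ) ^ k * (1 - x) ^ (k * 4 ^ q)
        ≤ Real.exp k * Real.exp (-(k * 2 ^ q)) := by
          refine mul_le_mul e3 e2 (pow_nonneg (by linarith) _) (Real.exp_pos _).le
      _ = Real.exp (-(k * (2 ^ q - 1))) := by rw [← Real.exp_add]; congr 1; ring
      _ ≤ Real.exp (-q) := by
          refine Real.exp_le_exp.2 (neg_le_neg ?_)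
          nlinarith
      _ ≤ 1 / q := by
          rw [Real.exp_neg, ← one_div]
          exact one_div_le_one_div_of_le (by linarith) (by linarith [Real.add_one_le_exp (q : ℝ)])
      _ ≤ ε / 2 := by
          rw [div_le_div_iff₀ (by linarith) (by norm_num)]
          linarith
  have hgain : ∀ S : Finset α, #S = k * 4 ^ q → ε / 4 * (k * q) ≤
      ∑ i, w i * seqAvg (1 / 2) q fun l =>
        (#(found (fun _ => ∅) (checkedAnswer k (b i) (a i S) S) l S) : ℝ) := by
    intro S hS
    simp_rw [fun i => seqAvg_found_static (1 / 2) (checkedAnswer k (b i) (a i S) S)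
      (checkedAnswer_subset k (b i) (a i S) S) q S, mul_sum]
    rw [sum_comm]
    have hterm : ∀ j ∈ range q, ε / 4 * k ≤ ∑ i, w i * ((1 - 1 / 2) * thin ((1 / 2) ^ j)
        (fun B => (#(checkedAnswer k (b i) (a i S) S B) : ℝ)) S) := by
      intro j hj
      have hp0 : (0 : ℝ) ≤ (1 / 2) ^ j := by positivity
      have hp1 : ((1 : ℝ) / 2) ^ j ≤ 1 := pow_le_one₀ (by norm_num) (by norm_num)
      have h1 : thin ((1 / 2 : ℝ) ^ j) (fun B => ε * k + (-(k * 2 ^ k)) * (1 / 2) ^ #B) S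
          ≤ thin ((1 / 2 : ℝ) ^ j)
            (fun B => ∑ i, w i * (#(checkedAnswer k (b i) (a i S) S B) : ℝ)) S := by
        refine thin_mono hp0 hp1 fun B hB => ?_
        rcases le_or_gt k #B with h | h
        · have := hsucc S B hS hB h
          have h' : (0 : ℝ) ≤ k * 2 ^ k * (1 / 2) ^ #B := by positivity
          linarith
        · have h' : (0 : ℝ) ≤ ∑ i, w i * (#(checkedAnswer k (b i) (a i S) S B) : ℝ) :=
            sum_nonneg fun i _ => mul_nonneg (hw0 i) (Nat.cast_nonneg _)
          refine le_trans ?_ h'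
          have h2 : (1 : ℝ) ≤ 2 ^ k * (1 / 2) ^ #B := by
            calc (1 : ℝ) = 2 ^ k * (1 / 2) ^ k := by rw [← mul_pow]; norm_num
              _ ≤ 2 ^ k * (1 / 2) ^ #B := mul_le_mul_of_nonneg_left
                  (pow_le_pow_of_le_one (by norm_num) (by norm_num) h.le) (by positivity)
          nlinarith
      rw [thin_add, thin_const, thin_const_mul, thin_pow_card, hS, thin_sum] at h1
      simp_rw [thin_const_mul] at h1
      have h3 := htail j hj
      have h4 : ∑ i, w i * ((1 - 1 / 2) * thin ((1 / 2) ^ j)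
          (fun B => (#(checkedAnswer k (b i) (a i S) S B) : ℝ)) S)
          = 1 / 2 * ∑ i, w i * thin ((1 / 2) ^ j)
          (fun B => (#(checkedAnswer k (b i) (a i S) S B) : ℝ)) S := by
        rw [mul_sum]
        exact sum_congr rfl fun i _ => by ring
      rw [h4]
      nlinarith
    calc ε / 4 * (k * q) = #(range q) • (ε / 4 * k) := by
          rw [card_range, nsmul_eq_mul]; ring
      _ ≤ _ := card_nsmul_le_sum _ _ _ hterm
  set d := ⌊ε * k * q / 8⌋₊ with hd
  have hd1 : (d : ℝ) ≤ ε / 4 / 2 * (k * q) := by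
    refine (Nat.floor_le (by positivity)).trans (le_of_eq (by ring))
  have hd2 : ε * k * q / 8 - 1 ≤ d := (Nat.sub_one_lt_floor _).le
  have key := encoding_bound (fun _ => ∅) (fun _ => empty_subset _) hm a b w hw0 hw1
    (by norm_num) (by norm_num) (by positivity : 0 < ε / 4) hk hq0 hd1 hgain
  have h8 : (1 : ℝ) / 2 ^ q ≤ ε / 4 / 2 := by
    rw [div_le_iff₀ (by positivity)]
    nlinarith
  rw [hM] at key
  have hexp := exponent_le_of_encoding_bound (by positivity) (scale_mul_le_sub hq0 hn) h8 key
  have hexp' : (q : ℝ) * d ≤ s + q + q := by exact_mod_cast hexp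
  have h5 : (q : ℝ) * (ε * k * q / 8 - 1) ≤ q * d := by gcongr
  have h6 : 48 * (q : ℝ) ≤ ε * q * k * q := by
    have : 48 * 1 * (q : ℝ) ≤ ε * q * k * q := by gcongr
    linarith
  nlinarith

/-- If each round fails with probability at most `2 ^ (-8 K)`, then `K` elements can be found one
at a time adaptively at each of `q` scales, and the message has `Ω(K q²)` bits. -/
theorem adaptive_bound {s K q : ℕ} {δ : ℝ} (hM : Fintype.card M = 2 ^ s) (hK : 0 < K)
    (hδ0 : 0 ≤ δ) (hδ : δ ≤ (1 / 2) ^ (8 * K)) (hq : 18 ≤ q) (hn : K * 16 ^ q ≤ Fintype.card α)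
    (a : ι → Finset α → M) (b : ι → M → Finset α → Finset α) (w : ι → ℝ) (hw0 : ∀ i, 0 ≤ w i)
    (hw1 : ∑ i, w i = 1)
    (hsucc : ∀ S A : Finset α, #S = K * 4 ^ q → A ⊆ S → 1 ≤ #A →
      1 - δ ≤ ∑ i, w i * #(checkedAnswer 1 (b i) (a i S) S A)) :
    (K : ℝ) * q ^ 2 / 16 ≤ s := by
  have hq18 : (18 : ℝ) ≤ q := by exact_mod_cast hq
  have hq0 : 0 < q := by omega
  have hK1 : (1 : ℝ) ≤ K := by exact_mod_cast hK
  have hK0 : (0 : ℝ) < K := by linarith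
  have hm : K * 4 ^ q ≤ Fintype.card α :=
    le_trans (Nat.mul_le_mul_left _ (Nat.pow_le_pow_left (by norm_num) q)) hn
  set p : ℝ := (1 + (K : ℝ)⁻¹)⁻¹ with hp
  have hKinv : (0 : ℝ) < (K : ℝ)⁻¹ := by positivity
  have hp0 : 0 < p := by positivity
  have hp1 : p < 1 := inv_lt_one_of_one_lt₀ (by linarith)
  -- After `K * q` rounds, at least `7 * K` elements are expected to be left.
  have hpR : 7 * (K : ℝ) ≤ p ^ (K * q) * (K * 4 ^ q : ℕ) := by
    have h1 : (1 + (K : ℝ)⁻¹) ^ K ≤ 3 := by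
      calc (1 + (K : ℝ)⁻¹) ^ K ≤ Real.exp (K : ℝ)⁻¹ ^ K :=
            pow_le_pow_left₀ (by positivity) (by linarith [Real.add_one_le_exp (K : ℝ)⁻¹]) _
        _ = Real.exp 1 := by rw [← Real.exp_nat_mul]; congr 1; field_simp
        _ ≤ 3 := by linarith [Real.exp_one_lt_d9]
    have h2 : (1 / 3 : ℝ) ^ q ≤ p ^ (K * q) := by
      rw [pow_mul]
      refine pow_le_pow_left₀ (by norm_num) ?_ q
      rw [hp, inv_pow, ← one_div]
      exact one_div_le_one_div_of_le (by positivity) h1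
    have h3 : (7 : ℝ) ≤ (1 / 3) ^ q * 4 ^ q := by
      rw [← mul_pow]
      have := one_add_mul_le_pow (by norm_num : (-2 : ℝ) ≤ 1 / 3) q
      norm_num at this ⊢
      linarith
    push_cast
    calc 7 * (K : ℝ) ≤ (1 / 3) ^ q * 4 ^ q * K := by gcongr
      _ = (1 / 3) ^ q * (K * 4 ^ q) := by ring
      _ ≤ _ := by gcongr
  have htail : ∀ j ∈ range (K * q), adaptivityLoss p j * (δ + (1 - p ^ j) ^ (K * 4 ^ q)) ≤ 1 / 2 := by
    intro j hj
    have hj' : p ^ (K * q) ≤ p ^ j := pow_le_pow_of_le_one hp0.le hp1.le (mem_range.1 hj).le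
    have hj1 : p ^ j ≤ 1 := pow_le_one₀ hp0.le hp1.le
    have e1 : (1 - p ^ j) ^ (K * 4 ^ q) ≤ Real.exp (-(7 * K)) := by
      calc (1 - p ^ j) ^ (K * 4 ^ q) ≤ Real.exp (-p ^ j) ^ (K * 4 ^ q) :=
            pow_le_pow_left₀ (by linarith) (by linarith [Real.add_one_le_exp (-p ^ j)]) _
        _ = Real.exp (-(p ^ j * (K * 4 ^ q : ℕ))) := by
            rw [← Real.exp_nat_mul]; congr 1; ring
        _ ≤ _ := by
            refine Real.exp_le_exp.2 (neg_le_neg (hpR.trans ?_))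
            gcongr
    have e2 : Real.exp (4 * K) * δ ≤ 1 / 4 := by
      have h1 : Real.exp (4 * K) ≤ 64 ^ K := by
        calc Real.exp (4 * K) = (Real.exp 1 ^ 4) ^ K := by
              rw [← pow_mul, ← Real.exp_nat_mul]; congr 1; push_cast; ring
          _ ≤ 64 ^ K := by
              refine pow_le_pow_left₀ (by positivity) ?_ K
              calc Real.exp 1 ^ 4 ≤ (2.8 : ℝ) ^ 4 := by
                    refine pow_le_pow_left₀ (Real.exp_pos _).le ?_ 4
                    linarith [Real.exp_one_lt_d9]
                _ ≤ 64 := by norm_num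
      calc Real.exp (4 * K) * δ ≤ 64 ^ K * (1 / 2) ^ (8 * K) := by gcongr
        _ = (1 / 4) ^ K := by rw [pow_mul, ← mul_pow]; norm_num
        _ ≤ (1 / 4) ^ 1 := pow_le_pow_of_le_one (by norm_num) (by norm_num) hK
        _ = 1 / 4 := pow_one _
    have e3 : Real.exp (4 * K) * Real.exp (-(7 * K)) ≤ 1 / 4 := by
      rw [← Real.exp_add]
      calc Real.exp (4 * K + -(7 * K)) ≤ Real.exp (-3) := Real.exp_le_exp.2 (by linarith)
        _ ≤ 1 / 4 := by
          rw [Real.exp_neg, ← one_div]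
          exact one_div_le_one_div_of_le (by norm_num) (by linarith [Real.add_one_le_exp (3 : ℝ)])
    calc adaptivityLoss p j * (δ + (1 - p ^ j) ^ (K * 4 ^ q))
        ≤ Real.exp (4 * K) * (δ + Real.exp (-(7 * K))) := by
          refine mul_le_mul (adaptivityLoss_le hK j) (by linarith) ?_ (Real.exp_pos _).le
          exact add_nonneg hδ0 (pow_nonneg (by linarith) _)
      _ ≤ 1 / 2 := by rw [mul_add]; linarith
  have hgain : ∀ S : Finset α, #S = K * 4 ^ q → 1 / 2 * ((1 : ℕ) * (K * q : ℕ) : ℝ) ≤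
      ∑ i, w i * seqAvg p (K * q) fun l =>
        (#(found (fun B => B) (checkedAnswer 1 (b i) (a i S) S) l S) : ℝ) := by
    intro S hS
    have hstep : ∀ i, w i * (((K * q : ℕ) : ℝ) - ∑ j ∈ range (K * q), adaptivityLoss p j *
        thin (p ^ j) (fun B => 1 - (#(checkedAnswer 1 (b i) (a i S) S B) : ℝ)) S)
        ≤ w i * seqAvg p (K * q) fun l =>
        (#(found (fun B => B) (checkedAnswer 1 (b i) (a i S) S) l S) : ℝ) := fun i =>
      mul_le_mul_of_nonneg_left (le_seqAvg_found_adaptive hp0.le hp1 _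
        (checkedAnswer_subset 1 (b i) (a i S) S) (card_checkedAnswer_le 1 (b i) (a i S) S) _ S)
        (hw0 i)
    refine le_trans ?_ (sum_le_sum fun i _ => hstep i)
    simp_rw [mul_sub, sum_sub_distrib, ← sum_mul, hw1, one_mul, mul_sum]
    rw [sum_comm]
    have hterm : ∀ j ∈ range (K * q), ∑ i, w i * (adaptivityLoss p j *
        thin (p ^ j) (fun B => 1 - (#(checkedAnswer 1 (b i) (a i S) S B) : ℝ)) S) ≤ 1 / 2 := by
      intro j hj
      have hpj0 : 0 ≤ p ^ j := pow_nonneg hp0.le _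
      have hpj1 : p ^ j ≤ 1 := pow_le_one₀ hp0.le hp1.le
      have h1 : thin (p ^ j)
            (fun B => ∑ i, w i * (1 - (#(checkedAnswer 1 (b i) (a i S) S B) : ℝ))) S
          ≤ thin (p ^ j) (fun B => δ + 0 ^ #B) S := by
        refine thin_mono hpj0 hpj1 fun B hB => ?_
        simp_rw [mul_sub, mul_one, sum_sub_distrib, hw1]
        rcases Nat.eq_zero_or_pos #B with h | h
        · have h' : (0 : ℝ) ≤ ∑ i, w i * (#(checkedAnswer 1 (b i) (a i S) S B) : ℝ) :=
            sum_nonneg fun i _ => mul_nonneg (hw0 i) (Nat.cast_nonneg _)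
          rw [h, pow_zero]
          linarith
        · rw [zero_pow h.ne']
          linarith [hsucc S B hS hB h]
      rw [thin_add, thin_const, thin_pow_card, hS, thin_sum, mul_zero, add_zero] at h1
      simp_rw [thin_const_mul] at h1
      calc _ = adaptivityLoss p j * ∑ i, w i *
            thin (p ^ j) (fun B => 1 - (#(checkedAnswer 1 (b i) (a i S) S B) : ℝ)) S := by
            rw [mul_sum]
            exact sum_congr rfl fun i _ => by ring
        _ ≤ adaptivityLoss p j * (δ + (1 - p ^ j) ^ (K * 4 ^ q)) :=
            mul_le_mul_of_nonneg_left h1 (adaptivityLoss_nonneg hp0.le hp1.le j)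
        _ ≤ 1 / 2 := htail j hj
    have hall := sum_le_card_nsmul _ _ _ hterm
    rw [card_range, nsmul_eq_mul] at hall
    push_cast at hall ⊢
    linarith
  set d := ⌊(K : ℝ) * q / 4⌋₊ with hd
  have hd1 : (d : ℝ) ≤ 1 / 2 / 2 * ((1 : ℕ) * (K * q : ℕ)) := by
    refine (Nat.floor_le (by positivity)).trans (le_of_eq (by push_cast; ring))
  have hd2 : (K : ℝ) * q / 4 - 1 ≤ d := (Nat.sub_one_lt_floor _).le
  have key := encoding_bound (fun B => B) (fun _ => subset_rfl) hm a b w hw0 hw1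
    hp0.le hp1.le (by norm_num : (0 : ℝ) < 1 / 2) one_pos (Nat.mul_pos hK hq0) hd1 hgain
  rw [hM] at key
  have hexp := exponent_le_of_encoding_bound (u := 2) (by positivity) (scale_mul_le_sub hq0 hn)
    (by norm_num) key
  have hexp' : (q : ℝ) * d ≤ s + K * q + 2 := by exact_mod_cast hexp
  have h5 : (q : ℝ) * (K * q / 4 - 1) ≤ q * d := by gcongr
  have h6 : 18 * (K * q : ℝ) ≤ q * (K * q) := by gcongr
  have h7 : 1 * (q : ℝ) ≤ K * q := by gcongr
  nlinarith

end StrategyBounds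

/-! ### From protocols to finite strategies -/

section ProtocolToStrategy

/-- The indicator vector of a set of coordinates. -/
def indicatorVec {n : ℕ} (S : Finset (Fin n)) : Fin n → Bool := fun i => decide (i ∈ S)

@[simp]
theorem bitSupport_indicatorVec {n : ℕ} (S : Finset (Fin n)) :
    bitSupport (indicatorVec S) = S := by
  ext i
  simp [bitSupport, indicatorVec]

theorem diffSet_eq_sdiff {n : ℕ} {x y : Fin n → Bool} (h : bitSupport y ⊆ bitSupport x) :
    diffSet x y = bitSupport x \ bitSupport y := by
  ext i
  have hi : y i = true → x i = true := by simpa [bitSupport] using @h i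
  simp only [diffSet, bitSupport, mem_filter, mem_univ, true_and, mem_sdiff]
  cases hx : x i <;> cases hy : y i <;> simp_all

theorem diffSet_indicatorVec {n : ℕ} {S A : Finset (Fin n)} (h : A ⊆ S) :
    diffSet (indicatorVec S) (indicatorVec (S \ A)) = A := by
  rw [diffSet_eq_sdiff (by simp), bitSupport_indicatorVec, bitSupport_indicatorVec,
    Finset.sdiff_sdiff_eq_self h]

/-- A subset of `C` of size `k`, or the empty set if `C` is too small. -/
noncomputable def truncateCard {α : Type*} (k : ℕ) (C : Finset α) : Finset α :=
  if h : k ≤ #C then (exists_subset_card_eq h).choose else ∅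

theorem truncateCard_spec {α : Type*} {k : ℕ} {C : Finset α} (h : k ≤ #C) :
    truncateCard k C ⊆ C ∧ #(truncateCard k C) = k := by
  rw [truncateCard, dif_pos h]
  exact (exists_subset_card_eq h).choose_spec

/-- A protocol only uses its coins through the functions that Alice and Bob compute on sets, of
which there are finitely many. Hence a protocol for finding `k` differences amounts to a finite
distribution `w` over pairs of such functions, and it may be used for finding `k' ≤ k`
differences. -/
theorem exists_strategy_distribution {n k k' s : ℕ} {δ : ℝ} (hδ : 0 ≤ δ)
    (π : PublicCoinProtocol (URSubset n k) s) (hπ : π.Solves δ) (m : ℕ) (hk' : k' ≤ k)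
    (hk'0 : 0 < k') :
    ∃ w : (Finset (Fin n) → (Fin s → Bool)) ×
        ((Fin s → Bool) → Finset (Fin n) → Finset (Fin n)) → ℝ,
      (∀ i, 0 ≤ w i) ∧ ∑ i, w i = 1 ∧ ∀ S A : Finset (Fin n), #S = m → A ⊆ S → k' ≤ #A →
        (1 - δ) * k' ≤ ∑ i, w i * #(checkedAnswer k' i.2 (i.1 S) S A) := by
  classical
  let F : π.Coins → (Finset (Fin n) → (Fin s → Bool)) ×
      ((Fin s → Bool) → Finset (Fin n) → Finset (Fin n)) := fun r =>
    (fun S => π.alice r (indicatorVec S),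
      fun μ y => truncateCard k' (π.bob r μ (indicatorVec y, m)))
  let P := π.coinDist.map F
  have hP1 : ∑ i, (P i).toReal = 1 := by
    rw [← ENNReal.toReal_sum fun i _ => P.apply_ne_top i, ← tsum_fintype (L := .unconditional _),
      P.tsum_coe, ENNReal.toReal_one]
  refine ⟨fun i => (P i).toReal, fun i => ENNReal.toReal_nonneg, hP1, ?_⟩
  intro S A hS hA hkA
  set G := {i : (Finset (Fin n) → (Fin s → Bool)) ×
      ((Fin s → Bool) → Finset (Fin n) → Finset (Fin n)) |
      #(checkedAnswer k' i.2 (i.1 S) S A) = k'} with hG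
  have hsucc : ∀ r, (URSubset n k).correct (indicatorVec S) (indicatorVec (S \ A), m)
      (π.bob r (π.alice r (indicatorVec S)) (indicatorVec (S \ A), m)) → F r ∈ G := by
    intro r hr
    obtain ⟨C, hC⟩ : ∃ C : Finset (Fin n),
        C = π.bob r (π.alice r (indicatorVec S)) (indicatorVec (S \ A), m) := ⟨_, rfl⟩
    obtain ⟨h1, h2⟩ : C ⊆ diffSet (indicatorVec S) (indicatorVec (S \ A)) ∧
        #C = min k #(diffSet (indicatorVec S) (indicatorVec (S \ A))) := hC ▸ hr
    rw [diffSet_indicatorVec hA] at h1 h2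
    obtain ⟨h3, h4⟩ := truncateCard_spec (h2 ▸ le_min hk' hkA : k' ≤ #C)
    have hF : (F r).2 ((F r).1 S) (S \ A) = truncateCard k' C := congrArg (truncateCard k') hC.symm
    change #(checkedAnswer k' (F r).2 ((F r).1 S) S A) = k'
    rw [checkedAnswer, hF, if_pos ⟨h3.trans h1, h4⟩]
    exact h4
  have hprom : (URSubset n k).promise (indicatorVec S) (indicatorVec (S \ A), m) := by
    refine ⟨?_, ?_⟩
    · simp only [bitSupport_indicatorVec]
      exact sdiff_ssubset hA (card_pos.1 (hk'0.trans_le hkA))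
    · simp [hS]
  have hfail : ∑ i with i ∉ G, (P i).toReal ≤ δ := by
    have h1 : P.toOuterMeasure {i | i ∉ G} ≤ ENNReal.ofReal δ := by
      rw [PMF.toOuterMeasure_map_apply]
      refine le_trans (MeasureTheory.measure_mono fun r hr => ?_) (hπ _ _ hprom)
      exact fun hc => hr (hsucc r hc)
    have h2 : P.toOuterMeasure {i | i ∉ G} = ∑ i with i ∉ G, P i := by
      rw [← PMF.toOuterMeasure_apply_finset]
      congr 1
      ext i
      simp
    rw [← ENNReal.toReal_sum fun i _ => P.apply_ne_top i, ← h2]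
    exact ENNReal.toReal_le_of_le_ofReal hδ h1
  have hsplit := sum_filter_add_sum_filter_not univ (fun i => i ∈ G) fun i => (P i).toReal
  rw [hP1] at hsplit
  calc (1 - δ) * k' ≤ (∑ i with i ∈ G, (P i).toReal) * k' := by
        gcongr
        linarith
    _ = ∑ i with i ∈ G, (P i).toReal * #(checkedAnswer k' i.2 (i.1 S) S A) := by
        rw [sum_mul]
        refine sum_congr rfl fun i hi => ?_
        have : #(checkedAnswer k' i.2 (i.1 S) S A) = k' := (mem_filter.1 hi).2
        rw [this]
    _ ≤ _ := by
        refine sum_le_sum_of_subset_of_nonneg (filter_subset _ _) fun i _ _ => ?_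
        exact mul_nonneg ENNReal.toReal_nonneg (Nat.cast_nonneg _)

end ProtocolToStrategy

/-! ### The lower bound -/

section LowerBound

/-- The number `q` of scales, for which `n / k` is `16 ^ q` up to a constant factor. -/
theorem exists_scale {k n q₀ : ℕ} (hk : 0 < k) (hq₀ : 1 ≤ q₀) (h : k * 16 ^ q₀ ≤ n) :
    ∃ q, q₀ ≤ q ∧ k * 16 ^ q ≤ n ∧ Real.logb 2 ((n : ℝ) / k) ≤ 8 * q := by
  have hk0 : (0 : ℝ) < k := by exact_mod_cast hk
  have h1 : 16 ^ q₀ ≤ n / k := (Nat.le_div_iff_mul_le hk).2 (by rwa [mul_comm])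
  have hne : n / k ≠ 0 := by
    have : 0 < 16 ^ q₀ := by positivity
    omega
  have hq : q₀ ≤ Nat.log 16 (n / k) := (Nat.le_log_iff_pow_le (by norm_num) hne).2 h1
  have hle : k * 16 ^ Nat.log 16 (n / k) ≤ n := by
    have := (Nat.le_div_iff_mul_le hk).1 (Nat.pow_log_le_self 16 hne)
    rwa [mul_comm]
  have hlt : n < 16 ^ (Nat.log 16 (n / k) + 1) * k :=
    (Nat.div_lt_iff_lt_mul hk).1 (Nat.lt_pow_succ_log_self (by norm_num) _)
  refine ⟨Nat.log 16 (n / k), hq, hle, ?_⟩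
  set q := Nat.log 16 (n / k)
  have hn0 : 0 < n := lt_of_lt_of_le (by positivity) h
  have hn0' : (0 : ℝ) < n := by exact_mod_cast hn0
  have h2 : (n : ℝ) / k ≤ 2 ^ (4 * (q + 1)) := by
    rw [div_le_iff₀ hk0, pow_mul]
    norm_num
    exact_mod_cast hlt.le
  calc Real.logb 2 ((n : ℝ) / k) ≤ Real.logb 2 (2 ^ (4 * (q + 1))) :=
        Real.logb_le_logb_of_le (by norm_num) (by positivity) h2
    _ = ((4 * (q + 1) : ℕ) : ℝ) := by
        rw [Real.logb_pow, Real.logb_self_eq_one (by norm_num), mul_one]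
    _ ≤ 8 * q := by
        have : (1 : ℝ) ≤ q := by exact_mod_cast hq₀.trans hq
        push_cast
        linarith

/-- The lower bound `Ω(k' log² (n / k'))` that comes from finding `k' ≤ k` elements per round. -/
theorem static_lower_bound {n k k' s q₀ : ℕ} {δ ε : ℝ} (hε : 0 < ε) (hε1 : ε ≤ 1) (hδ0 : 0 ≤ δ)
    (hδ : δ ≤ 1 - ε) (π : PublicCoinProtocol (URSubset n k) s) (hπ : π.Solves δ)
    (hk'0 : 0 < k') (hk' : k' ≤ k) (hq₀ : 48 / ε ≤ q₀) (hn : k' * 16 ^ q₀ ≤ n) :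
    ε / 1024 * (k' * Real.logb 2 ((n : ℝ) / k') ^ 2) ≤ s := by
  have hq1 : 1 ≤ q₀ := by
    have : (0 : ℝ) < q₀ := lt_of_lt_of_le (by positivity) hq₀
    exact_mod_cast this
  obtain ⟨q, hqq, hnq, hlog⟩ := exists_scale hk'0 hq1 hn
  obtain ⟨w, hw0, hw1, hw⟩ := exists_strategy_distribution hδ0 π hπ (k' * 4 ^ q) hk' hk'0
  have hmain := static_bound (α := Fin n) (M := Fin s → Bool) (s := s) (q := q) (by simp) hk'0 hε
    hε1 (hq₀.trans (by exact_mod_cast hqq)) (by simpa using hnq) (fun i => i.1) (fun i => i.2) w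
    hw0 hw1 fun S A hS hA hkA => by
      refine le_trans ?_ (hw S A hS hA hkA)
      gcongr
      linarith
  refine le_trans ?_ hmain
  have hlog0 : 0 ≤ Real.logb 2 ((n : ℝ) / k') := by
    have hk0 : (0 : ℝ) < k' := by exact_mod_cast hk'0
    apply Real.logb_nonneg (by norm_num)
    rw [le_div_iff₀ hk0, one_mul]
    exact_mod_cast le_trans (Nat.le_mul_of_pos_right _ (by positivity)) hn
  have hsq : Real.logb 2 ((n : ℝ) / k') ^ 2 ≤ (8 * q) ^ 2 := pow_le_pow_left₀ hlog0 hlog 2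
  calc ε / 1024 * (k' * Real.logb 2 ((n : ℝ) / k') ^ 2) ≤ ε / 1024 * (k' * (8 * q) ^ 2) := by gcongr
    _ = ε * k' * q ^ 2 / 16 := by ring

/-- The lower bound `Ω(t log² (n / t))` for failure probability `2 ^ (-t)`, from single elements. -/
theorem adaptive_lower_bound {n k s : ℕ} {δ t : ℝ} (hδ0 : 0 ≤ δ) (ht : 8 ≤ t)
    (hδ : δ ≤ 2 ^ (-t)) (π : PublicCoinProtocol (URSubset n k) s) (hπ : π.Solves δ)
    (hk : 1 ≤ k) (hn : t * 16 ^ 18 ≤ n) :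
    1 / 16384 * (t * Real.logb 2 ((n : ℝ) / t) ^ 2) ≤ s := by
  set K := ⌊t / 8⌋₊ with hK
  have hKt : (K : ℝ) ≤ t / 8 := Nat.floor_le (by linarith)
  have hKt' : t / 8 < K + 1 := Nat.lt_floor_add_one _
  have hK0 : 0 < K := Nat.floor_pos.2 (by linarith)
  have hK1 : (1 : ℝ) ≤ K := by exact_mod_cast hK0
  have hKn : K * 16 ^ 18 ≤ n := by
    have : (K : ℝ) * 16 ^ 18 ≤ n := le_trans (by gcongr; linarith) hn
    exact_mod_cast this
  obtain ⟨q, hqq, hnq, hlog⟩ := exists_scale hK0 (by norm_num) hKn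
  have hδK : δ ≤ (1 / 2) ^ (8 * K) := by
    refine hδ.trans ?_
    rw [Real.rpow_neg (by norm_num), one_div, inv_pow]
    apply inv_anti₀ (by positivity)
    rw [← Real.rpow_natCast]
    apply Real.rpow_le_rpow_of_exponent_le (by norm_num)
    push_cast
    linarith
  obtain ⟨w, hw0, hw1, hw⟩ := exists_strategy_distribution hδ0 π hπ (K * 4 ^ q) hk one_pos
  have hmain := adaptive_bound (α := Fin n) (M := Fin s → Bool) (s := s) (q := q) (by simp) hK0 hδ0
    hδK hqq (by simpa using hnq) (fun i => i.1) (fun i => i.2) w hw0 hw1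
    fun S A hS hA hkA => by simpa using hw S A hS hA hkA
  refine le_trans ?_ hmain
  have ht0 : 0 < t := by linarith
  have hnt : 1 ≤ (n : ℝ) / t := by
    rw [le_div_iff₀ ht0]
    linarith
  have hlog0 : 0 ≤ Real.logb 2 ((n : ℝ) / t) := Real.logb_nonneg (by norm_num) hnt
  have hlog' : Real.logb 2 ((n : ℝ) / t) ≤ 8 * q := by
    refine le_trans ?_ hlog
    apply Real.logb_le_logb_of_le (by norm_num) (by linarith)
    gcongr
    linarith
  have hsq : Real.logb 2 ((n : ℝ) / t) ^ 2 ≤ (8 * q) ^ 2 := pow_le_pow_left₀ hlog0 hlog' 2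
  calc 1 / 16384 * (t * Real.logb 2 ((n : ℝ) / t) ^ 2)
      ≤ 1 / 16384 * ((16 * (K : ℝ)) * (8 * (q : ℝ)) ^ 2) := by
        gcongr
        linarith
    _ = (K : ℝ) * q ^ 2 / 16 := by ring

theorem urRate_le_self (n : ℕ) (t : ℝ) : urRate n t ≤ n := by
  unfold urRate
  split_ifs
  · exact min_le_left _ _
  · exact le_rfl

theorem urRate_le_of_le {n : ℕ} {t : ℝ} (h : t ≤ (n : ℝ) / 2) :
    urRate n t ≤ t * Real.logb 2 ((n : ℝ) / t) ^ 2 := by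
  rw [urRate, if_pos h]
  exact min_le_right _ _

/-- The lower bound. It is enough to treat `k` and `log (1 / δ)` that are at most a small constant
times `n`, as the problem only becomes harder when `k` grows or `δ` decreases. -/
theorem lower_bound {n k s q₀ : ℕ} {δ ε : ℝ} (hε : 0 < ε) (hε1 : ε ≤ 1) (hδ0 : 0 < δ)
    (hδ : δ ≤ 1 - ε) (hk : 1 ≤ k) (π : PublicCoinProtocol (URSubset n k) s) (hπ : π.Solves δ)
    (hq₀ : 48 / ε ≤ q₀) (hq18 : 18 ≤ q₀) (hn : 8 * 16 ^ q₀ ≤ n) :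
    ε / (16384 * 16 ^ q₀) * urRate n (max (k : ℝ) (Real.logb 2 (1 / δ))) ≤ s := by
  set N : ℕ := 16 ^ q₀ with hN
  set lam := Real.logb 2 (1 / δ) with hlam
  have hN18 : 16 ^ 18 ≤ N := Nat.pow_le_pow_right (by norm_num) hq18
  have hN18' : (16 : ℝ) ^ 18 ≤ N := by exact_mod_cast hN18
  have hN16 : (16 : ℝ) ≤ N := le_trans (by norm_num) hN18'
  have hN0 : (0 : ℝ) < N := by linarith
  have hn' : 8 * (N : ℝ) ≤ n := by exact_mod_cast hn
  have hn0 : (0 : ℝ) < n := by linarith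
  have hcN : (16 : ℝ) ^ q₀ = N := by rw [hN]; push_cast; rfl
  rw [hcN]
  have hc : ε / (16384 * N) ≤ ε / 16384 := by
    gcongr
    linarith
  rcases le_or_gt lam (8 * k) with hcase | hcase
  · have ht : max (k : ℝ) lam ≤ 8 * k := max_le (by linarith [(Nat.cast_nonneg k : (0 : ℝ) ≤ k)]) hcase
    have hk1 : (1 : ℝ) ≤ k := by exact_mod_cast hk
    rcases le_or_gt k (n / N) with hkn | hkn
    · have hkN : k * N ≤ n := (Nat.le_div_iff_mul_le (by positivity)).1 hkn
      have hkN' : (k : ℝ) * N ≤ n := by exact_mod_cast hkN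
      have hb := static_lower_bound hε hε1 hδ0.le hδ π hπ hk le_rfl hq₀ hkN
      set t := max (k : ℝ) lam
      have hkt : (k : ℝ) ≤ t := le_max_left _ _
      have htn : t ≤ (n : ℝ) / 2 := by nlinarith
      have ht0 : 0 < t := by linarith
      have h1 := urRate_le_of_le htn
      have hl0 : 0 ≤ Real.logb 2 ((n : ℝ) / t) := by
        apply Real.logb_nonneg (by norm_num)
        rw [le_div_iff₀ ht0]
        linarith
      have hl : Real.logb 2 ((n : ℝ) / t) ≤ Real.logb 2 ((n : ℝ) / k) := by
        apply Real.logb_le_logb_of_le (by norm_num) (by positivity)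
        gcongr
      have h2 : t * Real.logb 2 ((n : ℝ) / t) ^ 2
          ≤ 8 * k * Real.logb 2 ((n : ℝ) / k) ^ 2 := by gcongr
      calc ε / (16384 * N) * urRate n t
          ≤ ε / (16384 * N) * (8 * k * Real.logb 2 ((n : ℝ) / k) ^ 2) := by
            gcongr
            linarith
        _ ≤ ε / 16384 * (8 * k * Real.logb 2 ((n : ℝ) / k) ^ 2) := by gcongr
        _ ≤ ε / 1024 * (k * Real.logb 2 ((n : ℝ) / k) ^ 2) := by
            have : 0 ≤ ε * (k * Real.logb 2 ((n : ℝ) / k) ^ 2) := by positivity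
            linarith
        _ ≤ s := hb
    · set k' := n / N with hk'
      have hk'0 : 0 < k' := Nat.div_pos (by omega) (by positivity)
      have hkN : k' * N ≤ n := Nat.div_mul_le_self n N
      have hb := static_lower_bound hε hε1 hδ0.le hδ π hπ hk'0 hkn.le hq₀ hkN
      have hk'1 : (1 : ℝ) ≤ k' := by exact_mod_cast hk'0
      have hkN' : (k' : ℝ) * N ≤ n := by exact_mod_cast hkN
      have hlt : n < N * (k' + 1) := Nat.lt_mul_div_succ n (by positivity)
      have hlt' : (n : ℝ) < N * (k' + 1) := by exact_mod_cast hlt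
      have hl : 1 ≤ Real.logb 2 ((n : ℝ) / k') := by
        rw [Real.le_logb_iff_rpow_le (by norm_num) (by positivity), Real.rpow_one,
          le_div_iff₀ (by positivity)]
        nlinarith
      have hl2 : (1 : ℝ) ≤ Real.logb 2 ((n : ℝ) / k') ^ 2 := one_le_pow₀ hl
      calc ε / (16384 * N) * urRate n (max (k : ℝ) lam)
          ≤ ε / (16384 * N) * n := by
            gcongr
            exact urRate_le_self _ _
        _ ≤ ε / (16384 * N) * (N * (k' + k')) := by
            gcongr
            nlinarith
        _ = ε / 8192 * (k' * 1) := by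
            field_simp
            ring
        _ ≤ ε / 1024 * (k' * Real.logb 2 ((n : ℝ) / k') ^ 2) := by
            gcongr
            norm_num
        _ ≤ s := hb
  · have hk1 : (1 : ℝ) ≤ k := by exact_mod_cast hk
    have ht : max (k : ℝ) lam = lam := max_eq_right (by linarith)
    rw [ht]
    have hδlam : δ = 2 ^ (-lam) := by
      rw [hlam, Real.rpow_neg (by norm_num), Real.rpow_logb (by norm_num) (by norm_num)
        (by positivity), one_div, inv_inv]
    rcases le_or_gt lam (n / N : ℝ) with hln | hln
    · have hlN : lam * N ≤ n := (le_div_iff₀ hN0).1 hln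
      have hb := adaptive_lower_bound hδ0.le (by linarith : 8 ≤ lam) hδlam.le π hπ hk
        (le_trans (by gcongr; linarith) hlN)
      have hlam0 : 0 < lam := by linarith
      have h1 := urRate_le_of_le (n := n) (t := lam) (by nlinarith)
      calc ε / (16384 * N) * urRate n lam
          ≤ ε / (16384 * N) * (lam * Real.logb 2 ((n : ℝ) / lam) ^ 2) := by gcongr
        _ ≤ ε / 16384 * (lam * Real.logb 2 ((n : ℝ) / lam) ^ 2) := by gcongr
        _ ≤ 1 / 16384 * (lam * Real.logb 2 ((n : ℝ) / lam) ^ 2) := by gcongr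
        _ ≤ s := hb
    · have h8 : 8 ≤ (n : ℝ) / N := by rwa [le_div_iff₀ hN0]
      have hb := adaptive_lower_bound hδ0.le h8 (hδlam.le.trans
        (Real.rpow_le_rpow_of_exponent_le (by norm_num) (by linarith))) π hπ hk
        (by
          calc (n : ℝ) / N * 16 ^ 18 ≤ n / N * N := by gcongr
            _ = n := by field_simp)
      have hNn : (n : ℝ) / (n / N) = N := by field_simp
      rw [hNn] at hb
      have hl : 1 ≤ Real.logb 2 (N : ℝ) := by
        rw [Real.le_logb_iff_rpow_le (by norm_num) (by positivity), Real.rpow_one]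
        linarith
      have hl2 : (1 : ℝ) ≤ Real.logb 2 (N : ℝ) ^ 2 := one_le_pow₀ hl
      calc ε / (16384 * N) * urRate n lam ≤ ε / (16384 * N) * n := by
            gcongr
            exact urRate_le_self _ _
        _ ≤ 1 / (16384 * N) * n := by gcongr
        _ = 1 / 16384 * (n / N * 1) := by field_simp
        _ ≤ 1 / 16384 * (n / N * Real.logb 2 (N : ℝ) ^ 2) := by gcongr
        _ ≤ s := hb

end LowerBound

/-! ### Sampling and hashing with uniform coins -/

section UniformCoins

theorem exp_le_two_rpow {x : ℝ} (hx : 0 ≤ x) : Real.exp x ≤ 2 ^ (3 / 2 * x) := by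
  rw [Real.rpow_def_of_pos (by norm_num)]
  apply Real.exp_le_exp.2
  nlinarith [Real.log_two_gt_d9]

/-- The random set of coordinates kept at level `r`: coordinate `j` is kept if its uniform label
`ω j < 2 ^ L` is less than `2 ^ (L - r)`, which has probability `2 ^ (-r)`. -/
def sampleLevel {n L : ℕ} (ω : Fin n → Fin (2 ^ L)) (r : ℕ) : Finset (Fin n) :=
  {j | (ω j : ℕ) < 2 ^ (L - r)}

theorem sampleLevel_zero {n L : ℕ} (ω : Fin n → Fin (2 ^ L)) : sampleLevel ω 0 = univ := by
  ext j
  simp [sampleLevel]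

/-- The generating function of the number of elements of `D` that are kept at level `r`. -/
theorem sum_pow_card_inter_sampleLevel {n L r : ℕ} (hr : r ≤ L) (θ : ℝ) (D : Finset (Fin n)) :
    ∑ ω : Fin n → Fin (2 ^ L), θ ^ #(D ∩ sampleLevel ω r)
      = (Fintype.card (Fin n → Fin (2 ^ L)) : ℝ) * (1 + (θ - 1) * (1 / 2) ^ r) ^ #D := by
  have h1 : ∀ ω : Fin n → Fin (2 ^ L), θ ^ #(D ∩ sampleLevel ω r)
      = ∏ j, if j ∈ D then (if (ω j : ℕ) < 2 ^ (L - r) then θ else 1) else 1 := by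
    intro ω
    rw [prod_ite_mem, univ_inter, ← prod_filter, prod_const]
    congr 2
    ext j
    simp [sampleLevel]
  simp_rw [h1]
  have h2 := prod_univ_sum (fun _ : Fin n => (univ : Finset (Fin (2 ^ L))))
    fun j v => if j ∈ D then (if (v : ℕ) < 2 ^ (L - r) then θ else 1) else 1
  rw [Fintype.piFinset_univ] at h2
  rw [← h2]
  have hcard : #{v : Fin (2 ^ L) | (v : ℕ) < 2 ^ (L - r)} = 2 ^ (L - r) := by
    rw [Fin.card_filter_val_lt]
    exact min_eq_right (Nat.pow_le_pow_right (by norm_num) (Nat.sub_le _ _))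
  have hpow : (2 : ℝ) ^ (L - r) = 2 ^ L * (1 / 2) ^ r := by
    rw [pow_sub₀ _ (by norm_num) hr, one_div, inv_pow]
  have h3 : ∀ j : Fin n, (∑ v : Fin (2 ^ L),
      if j ∈ D then (if (v : ℕ) < 2 ^ (L - r) then θ else 1) else 1)
      = 2 ^ L * if j ∈ D then 1 + (θ - 1) * (1 / 2) ^ r else 1 := by
    intro j
    split_ifs with hj
    · have h4 : ∀ v : Fin (2 ^ L), (if (v : ℕ) < 2 ^ (L - r) then θ else 1)
          = (if (v : ℕ) < 2 ^ (L - r) then θ - 1 else 0) + 1 := by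
        intro v
        split_ifs <;> ring
      simp_rw [h4]
      rw [sum_add_distrib, ← sum_filter, sum_const, hcard, sum_const, card_univ, Fintype.card_fin]
      simp only [nsmul_eq_mul]
      push_cast
      rw [hpow]
      ring
    · simp
  simp_rw [h3]
  rw [prod_mul_distrib, prod_ite_mem, univ_inter, prod_const, prod_const]
  simp

/-- Two different arguments of a uniformly random function collide with the least possible
probability. -/
theorem card_collision_mul_le {A B : Type*} [Fintype A] [DecidableEq A] [Fintype B]
    [DecidableEq B] {a c : A} (h : a ≠ c) :
    #{f : A → B | f a = f c} * Fintype.card B ≤ Fintype.card (A → B) := by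
  rw [← card_univ (α := B), ← card_product, ← card_univ (α := A → B)]
  refine card_le_card_of_injOn (fun z => Function.update z.1 a z.2) (fun _ _ => mem_univ _) ?_
  rintro ⟨f, v⟩ hf ⟨f', v'⟩ hf' heq
  have hfa : f a = f c := by simpa using hf
  have hfa' : f' a = f' c := by simpa using hf'
  have hv : v = v' := by simpa using congrFun heq a
  have hne : ∀ x, x ≠ a → f x = f' x := fun x hx => by
    simpa [Function.update_of_ne hx] using congrFun heq x
  have hff : f = f' := by
    funext x
    by_cases hx : x = a
    · rw [hx, hfa, hfa', hne c h.symm]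
    · exact hne x hx
  rw [hff, hv]

/-- The number of small sets, by Markov's inequality for the weights `θ ^ #Z`. -/
theorem card_small_sets_le {n : ℕ} {t : ℝ} (ht : 0 < t) (htn : t ≤ n) :
    (#{Z : Finset (Fin n) | (#Z : ℝ) ≤ 32 * t} : ℝ)
      ≤ 2 ^ (32 * t * Real.logb 2 (n / t) + 2 * t) := by
  have hn0 : (0 : ℝ) < n := by linarith
  set θ : ℝ := t / n with hθ
  have hθ0 : 0 < θ := by positivity
  have hθ1 : θ ≤ 1 := (div_le_one hn0).2 htn
  have hsum : ∑ Z : Finset (Fin n), θ ^ #Z = (1 + θ) ^ n := by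
    have := Fintype.sum_pow_mul_eq_add_pow (Fin n) θ (1 : ℝ)
    simp only [one_pow, mul_one, Fintype.card_fin] at this
    rw [this, add_comm]
  have h1 : (#{Z : Finset (Fin n) | (#Z : ℝ) ≤ 32 * t} : ℝ) * θ ^ (32 * t) ≤ (1 + θ) ^ n := by
    rw [← hsum, ← nsmul_eq_mul]
    refine le_trans (card_nsmul_le_sum _ (fun Z => θ ^ #Z) _ fun Z hZ => ?_)
      (sum_le_sum_of_subset_of_nonneg (subset_univ _) fun _ _ _ => by positivity)
    rw [← Real.rpow_natCast]
    exact Real.rpow_le_rpow_of_exponent_ge hθ0 hθ1 (mem_filter.1 hZ).2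
  have h2 : (1 + θ) ^ n ≤ 2 ^ (2 * t) := by
    calc (1 + θ) ^ n ≤ Real.exp θ ^ n :=
          pow_le_pow_left₀ (by positivity) (by linarith [Real.add_one_le_exp θ]) n
      _ = Real.exp t := by
          rw [← Real.exp_nat_mul]
          congr 1
          rw [hθ]
          field_simp
      _ ≤ 2 ^ (3 / 2 * t) := exp_le_two_rpow ht.le
      _ ≤ 2 ^ (2 * t) := Real.rpow_le_rpow_of_exponent_le (by norm_num) (by linarith)
  have h3 : θ ^ (32 * t) = 2 ^ (-(32 * t * Real.logb 2 (n / t))) := by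
    have : θ = 2 ^ (-Real.logb 2 (n / t)) := by
      rw [Real.rpow_neg (by norm_num), Real.rpow_logb (by norm_num) (by norm_num) (by positivity),
        hθ, inv_div]
    conv_lhs => rw [this]
    rw [← Real.rpow_mul (by norm_num)]
    congr 1
    ring
  rw [h3, Real.rpow_neg (by norm_num), ← div_eq_mul_inv, div_le_iff₀ (by positivity)] at h1
  rw [Real.rpow_add (by norm_num)]
  refine h1.trans ?_
  rw [mul_comm ((1 + θ) ^ n)]
  gcongr

theorem failureProb_le_of_uniform {P : OneWayProblem} {s : ℕ} {Ω : Type} [Fintype Ω] [Nonempty Ω]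
    (alice : Ω → P.AliceInput → (Fin s → Bool))
    (bob : Ω → (Fin s → Bool) → P.BobInput → P.Answer) {δ : ℝ} (x : P.AliceInput)
    (y : P.BobInput) (Bad : Finset Ω) (hBad : ∀ r ∉ Bad, P.correct x y (bob r (alice r x) y))
    (hδ : (#Bad : ℝ) ≤ δ * Fintype.card Ω) :
    PublicCoinProtocol.failureProb ⟨Ω, PMF.uniformOfFintype Ω, alice, bob⟩ x y
      ≤ ENNReal.ofReal δ := by
  classical
  have hcard : (0 : ℝ) < Fintype.card Ω := by exact_mod_cast Fintype.card_pos
  have h1 : (PMF.uniformOfFintype Ω).toOuterMeasure (Bad : Set Ω) ≤ ENNReal.ofReal δ := by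
    rw [PMF.toOuterMeasure_uniformOfFintype_apply]
    have e : (Fintype.card (Bad : Set Ω) : ENNReal) = ENNReal.ofReal (#Bad : ℝ) := by
      simp
    rw [e, ← ENNReal.ofReal_natCast (Fintype.card Ω), ← ENNReal.ofReal_div_of_pos hcard]
    apply ENNReal.ofReal_le_ofReal
    rwa [div_le_iff₀ hcard]
  refine le_trans (MeasureTheory.measure_mono fun r hr => ?_) h1
  by_contra hB
  exact hr (hBad r hB)

end UniformCoins

/-! ### The upper bound -/

section UpperBound

/-- A level at which the expected number of kept elements of a set of size `d` is of order `t`. -/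
theorem exists_level {n d : ℕ} {t : ℝ} (ht : 1 ≤ t) (hd : d ≤ n) :
    ∃ r : ℕ, r ≤ ⌊Real.logb 2 ((n : ℝ) / t)⌋₊ ∧ (d : ℝ) * (1 / 2) ^ r ≤ 16 * t ∧
      (r = 0 ∨ 8 * t ≤ (d : ℝ) * (1 / 2) ^ r) := by
  classical
  have hex : ∃ r : ℕ, (d : ℝ) * (1 / 2) ^ r ≤ 16 * t := by
    refine ⟨d, ?_⟩
    have h1 : (d : ℝ) ≤ 2 ^ d := by exact_mod_cast Nat.lt_two_pow_self.le
    have h2 : (2 : ℝ) ^ d * (1 / 2) ^ d = 1 := by rw [← mul_pow]; norm_num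
    have h3 : (d : ℝ) * (1 / 2) ^ d ≤ 2 ^ d * (1 / 2) ^ d := by gcongr
    linarith
  have hspec := Nat.find_spec hex
  rcases Nat.eq_zero_or_pos (Nat.find hex) with h0 | h0
  · rw [h0] at hspec
    exact ⟨0, Nat.zero_le _, hspec, Or.inl rfl⟩
  · obtain ⟨r, hr⟩ : ∃ r, Nat.find hex = r + 1 := ⟨Nat.find hex - 1, by omega⟩
    have hmin := Nat.find_min hex (m := r) (by omega)
    rw [hr] at hspec
    have h8 : 8 * t ≤ (d : ℝ) * (1 / 2) ^ (r + 1) := by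
      rw [pow_succ]
      linarith
    refine ⟨r + 1, ?_, hspec, Or.inr h8⟩
    apply Nat.le_floor
    have hdn : (d : ℝ) ≤ n := by exact_mod_cast hd
    have h2 : (2 : ℝ) ^ (r + 1) * (1 / 2) ^ (r + 1) = 1 := by rw [← mul_pow]; norm_num
    have h3 : (2 : ℝ) ^ (r + 1) * (8 * t) ≤ 2 ^ (r + 1) * (d * (1 / 2) ^ (r + 1)) := by gcongr
    have h4 : (2 : ℝ) ^ (r + 1) * (d * (1 / 2) ^ (r + 1)) = d := by
      rw [mul_left_comm, h2, mul_one]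
    have h5 : (2 : ℝ) ^ (r + 1) * t ≤ n := by
      have : 0 < (2 : ℝ) ^ (r + 1) * t := by positivity
      linarith
    have h6 : (2 : ℝ) ^ (r + 1) ≤ n / t := by
      rw [le_div_iff₀ (by linarith)]
      exact h5
    rw [Real.le_logb_iff_rpow_le (by norm_num) (lt_of_lt_of_le (by positivity) h6),
      Real.rpow_natCast]
    exact h6

theorem card_few_kept_le {n L r k : ℕ} {t : ℝ} (hr : r ≤ L) (ht : 1 ≤ t) (hk : (k : ℝ) ≤ t)
    (D : Finset (Fin n)) (hD : 8 * t ≤ (#D : ℝ) * (1 / 2) ^ r) :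
    (#{ω : Fin n → Fin (2 ^ L) | #(D ∩ sampleLevel ω r) < k} : ℝ)
      ≤ 2 ^ (-t) / 4 * Fintype.card (Fin n → Fin (2 ^ L)) := by
  set W : ℝ := (Fintype.card (Fin n → Fin (2 ^ L)) : ℝ) with hW
  have hW0 : 0 ≤ W := Nat.cast_nonneg _
  set x : ℝ := (1 / 2) ^ r / 2 with hx
  have hx1 : x ≤ 1 := by
    have : ((1 : ℝ) / 2) ^ r ≤ 1 := pow_le_one₀ (by norm_num) (by norm_num)
    rw [hx]; linarith
  have hsum := sum_pow_card_inter_sampleLevel hr (1 / 2) D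
  rw [← hW, show 1 + ((1 : ℝ) / 2 - 1) * (1 / 2) ^ r = 1 - x by rw [hx]; ring] at hsum
  have h1 : (#{ω : Fin n → Fin (2 ^ L) | #(D ∩ sampleLevel ω r) < k} : ℝ) * (1 / 2) ^ k
      ≤ W * (1 - x) ^ #D := by
    rw [← hsum, ← nsmul_eq_mul]
    refine le_trans (card_nsmul_le_sum _ (fun ω => (1 / 2 : ℝ) ^ #(D ∩ sampleLevel ω r)) _
      fun ω hω => ?_)
      (sum_le_sum_of_subset_of_nonneg (subset_univ _) fun _ _ _ => by positivity)
    exact pow_le_pow_of_le_one (by norm_num) (by norm_num) (mem_filter.1 hω).2.le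
  have h2 : (1 - x) ^ #D ≤ Real.exp (-(4 * t)) := by
    calc (1 - x) ^ #D ≤ Real.exp (-x) ^ #D :=
          pow_le_pow_left₀ (by linarith) (by linarith [Real.add_one_le_exp (-x)]) _
      _ = Real.exp (-(x * #D)) := by rw [← Real.exp_nat_mul]; congr 1; ring
      _ ≤ Real.exp (-(4 * t)) := by
          refine Real.exp_le_exp.2 (neg_le_neg ?_)
          rw [hx]
          linarith
  have h3 : (2 : ℝ) ^ k ≤ Real.exp t := by
    calc (2 : ℝ) ^ k ≤ Real.exp 1 ^ k :=
          pow_le_pow_left₀ (by norm_num) (by linarith [Real.add_one_le_exp (1 : ℝ)]) _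
      _ = Real.exp k := Real.exp_one_pow k
      _ ≤ Real.exp t := Real.exp_le_exp.2 hk
  have h4 : Real.exp t * Real.exp (-(4 * t)) ≤ 2 ^ (-t) / 4 := by
    have e1 : (2 : ℝ) ^ t ≤ Real.exp t := by
      rw [← Real.exp_one_rpow]
      exact Real.rpow_le_rpow (by norm_num) (by linarith [Real.add_one_le_exp (1 : ℝ)])
        (by linarith)
    have e2 : (4 : ℝ) ≤ Real.exp (2 * t) := by
      have e3 := Real.add_one_le_exp t
      calc (4 : ℝ) = 2 * 2 := by norm_num
        _ ≤ Real.exp t * Real.exp t := by gcongr <;> linarith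
        _ = Real.exp (2 * t) := by rw [← Real.exp_add]; congr 1; ring
    rw [Real.rpow_neg (by norm_num), ← Real.exp_add, le_div_iff₀ (by norm_num)]
    calc Real.exp (t + -(4 * t)) * 4 ≤ Real.exp (t + -(4 * t)) * Real.exp (2 * t) := by gcongr
      _ = (Real.exp t)⁻¹ := by rw [← Real.exp_add, ← Real.exp_neg]; congr 1; ring
      _ ≤ (2 ^ t)⁻¹ := inv_anti₀ (by positivity) e1
  have h5 : (1 / 2 : ℝ) ^ k * 2 ^ k = 1 := by rw [← mul_pow]; norm_num
  calc (#{ω : Fin n → Fin (2 ^ L) | #(D ∩ sampleLevel ω r) < k} : ℝ)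
      = #{ω : Fin n → Fin (2 ^ L) | #(D ∩ sampleLevel ω r) < k} * (1 / 2) ^ k * 2 ^ k := by
        rw [mul_assoc, h5, mul_one]
    _ ≤ W * Real.exp (-(4 * t)) * Real.exp t := by
        refine mul_le_mul (h1.trans (by gcongr)) h3 (by positivity) (by positivity)
    _ = Real.exp t * Real.exp (-(4 * t)) * W := by ring
    _ ≤ 2 ^ (-t) / 4 * W := by gcongr

theorem four_le_two_rpow {x : ℝ} (hx : 2 ≤ x) : (4 : ℝ) ≤ 2 ^ x := by
  calc (4 : ℝ) = 2 ^ (2 : ℝ) := by norm_num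
    _ ≤ 2 ^ x := Real.rpow_le_rpow_of_exponent_le (by norm_num) hx

theorem card_many_kept_le {n L r : ℕ} {t : ℝ} (hr : r ≤ L) (ht : 1 ≤ t)
    (D : Finset (Fin n)) (hD : (#D : ℝ) * (1 / 2) ^ r ≤ 16 * t) :
    (#{ω : Fin n → Fin (2 ^ L) | 32 * t < #(D ∩ sampleLevel ω r)} : ℝ)
      ≤ 2 ^ (-t) / 4 * Fintype.card (Fin n → Fin (2 ^ L)) := by
  set W : ℝ := (Fintype.card (Fin n → Fin (2 ^ L)) : ℝ) with hW
  have hW0 : 0 ≤ W := Nat.cast_nonneg _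
  have hsum := sum_pow_card_inter_sampleLevel hr 2 D
  rw [← hW, show 1 + ((2 : ℝ) - 1) * (1 / 2) ^ r = 1 + (1 / 2) ^ r by ring] at hsum
  have h1 : (#{ω : Fin n → Fin (2 ^ L) | 32 * t < #(D ∩ sampleLevel ω r)} : ℝ) * 2 ^ (32 * t)
      ≤ W * (1 + (1 / 2) ^ r) ^ #D := by
    rw [← hsum, ← nsmul_eq_mul]
    refine le_trans (card_nsmul_le_sum _ (fun ω => (2 : ℝ) ^ #(D ∩ sampleLevel ω r)) _
      fun ω hω => ?_)
      (sum_le_sum_of_subset_of_nonneg (subset_univ _) fun _ _ _ => by positivity)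
    rw [← Real.rpow_natCast]
    exact Real.rpow_le_rpow_of_exponent_le (by norm_num) (mem_filter.1 hω).2.le
  have h2 : (1 + (1 / 2 : ℝ) ^ r) ^ #D ≤ 2 ^ (24 * t) := by
    calc (1 + (1 / 2 : ℝ) ^ r) ^ #D ≤ Real.exp ((1 / 2) ^ r) ^ #D :=
          pow_le_pow_left₀ (by positivity) (by linarith [Real.add_one_le_exp ((1 / 2 : ℝ) ^ r)]) _
      _ = Real.exp (#D * (1 / 2) ^ r) := by rw [← Real.exp_nat_mul]
      _ ≤ Real.exp (16 * t) := Real.exp_le_exp.2 hD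
      _ ≤ 2 ^ (3 / 2 * (16 * t)) := exp_le_two_rpow (by linarith)
      _ = 2 ^ (24 * t) := by congr 1; ring
  have h3 : (2 : ℝ) ^ (24 * t) * 4 ≤ 2 ^ (-t) * 2 ^ (32 * t) := by
    calc (2 : ℝ) ^ (24 * t) * 4 ≤ 2 ^ (24 * t) * 2 ^ (7 * t) := by
          gcongr
          exact four_le_two_rpow (by linarith)
      _ = 2 ^ (-t) * 2 ^ (32 * t) := by
          rw [← Real.rpow_add (by norm_num), ← Real.rpow_add (by norm_num)]
          congr 1
          ring
  have hpos : (0 : ℝ) < 2 ^ (32 * t) := by positivity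
  refine le_of_mul_le_mul_right ?_ hpos
  calc _ ≤ W * (1 + (1 / 2) ^ r) ^ #D := h1
    _ ≤ W * 2 ^ (24 * t) := by gcongr
    _ = W / 4 * (2 ^ (24 * t) * 4) := by ring
    _ ≤ W / 4 * (2 ^ (-t) * 2 ^ (32 * t)) := by gcongr
    _ = 2 ^ (-t) / 4 * W * 2 ^ (32 * t) := by ring

theorem one_le_logb_div {n : ℕ} {t : ℝ} (ht : 1 ≤ t) (htn : t ≤ (n : ℝ) / 2) :
    1 ≤ Real.logb 2 ((n : ℝ) / t) := by
  have h2 : (2 : ℝ) ≤ n / t := by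
    rw [le_div_iff₀ (by linarith)]
    linarith
  rw [Real.le_logb_iff_rpow_le (by norm_num) (by linarith), Real.rpow_one]
  exact h2

/-- A random hash function with `b ≥ 40 t log (n / t)` bits distinguishes `X` from all sets that
exceed `Y` by at most `32 t` elements. -/
theorem card_collisions_le {n b : ℕ} {t : ℝ} (ht : 1 ≤ t) (htn : t ≤ (n : ℝ) / 2)
    (hb : 40 * t * Real.logb 2 ((n : ℝ) / t) ≤ b) (X Y : Finset (Fin n)) :
    (#{h : Finset (Fin n) → (Fin b → Bool) |
        ∃ T, Y ⊆ T ∧ (#(T \ Y) : ℝ) ≤ 32 * t ∧ T ≠ X ∧ h T = h X} : ℝ)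
      ≤ 2 ^ (-t) / 4 * Fintype.card (Finset (Fin n) → (Fin b → Bool)) := by
  classical
  set W : ℝ := (Fintype.card (Finset (Fin n) → (Fin b → Bool)) : ℝ) with hW
  have hW0 : 0 ≤ W := Nat.cast_nonneg _
  set C : Finset (Finset (Fin n)) := {T | Y ⊆ T ∧ (#(T \ Y) : ℝ) ≤ 32 * t ∧ T ≠ X} with hC
  have hℓ : 1 ≤ Real.logb 2 ((n : ℝ) / t) := one_le_logb_div ht htn
  have hCcard : (#C : ℝ) ≤ 2 ^ (32 * t * Real.logb 2 ((n : ℝ) / t) + 2 * t) := by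
    refine le_trans ?_ (card_small_sets_le (n := n) (by linarith) (by linarith))
    have : #C ≤ #{Z : Finset (Fin n) | (#Z : ℝ) ≤ 32 * t} := by
      refine card_le_card_of_injOn (fun T => T \ Y) ?_ ?_
      · intro T hT
        have := (mem_filter.1 hT).2
        simpa using this.2.1
      · intro T hT T' hT' heq
        have h1 := (mem_filter.1 hT).2.1
        have h2 := (mem_filter.1 hT').2.1
        rw [← sdiff_union_of_subset h1, ← sdiff_union_of_subset h2]
        simp only at heq
        rw [heq]
    exact_mod_cast this
  have hunion : #{h : Finset (Fin n) → (Fin b → Bool) |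
      ∃ T, Y ⊆ T ∧ (#(T \ Y) : ℝ) ≤ 32 * t ∧ T ≠ X ∧ h T = h X}
      ≤ ∑ T ∈ C, #{h : Finset (Fin n) → (Fin b → Bool) | h T = h X} := by
    refine le_trans (card_le_card fun h hh => ?_) card_biUnion_le
    obtain ⟨T, h1, h2, h3, h4⟩ := (mem_filter.1 hh).2
    exact mem_biUnion.2 ⟨T, mem_filter.2 ⟨mem_univ _, h1, h2, h3⟩, mem_filter.2 ⟨mem_univ _, h4⟩⟩
  have hone : ∀ T ∈ C, (#{h : Finset (Fin n) → (Fin b → Bool) | h T = h X} : ℝ) ≤ W / 2 ^ b := by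
    intro T hT
    have h1 := card_collision_mul_le (B := Fin b → Bool) (mem_filter.1 hT).2.2.2
    have h2 : (#{h : Finset (Fin n) → (Fin b → Bool) | h T = h X} : ℝ)
        * Fintype.card (Fin b → Bool) ≤ W := by
      rw [hW]
      exact_mod_cast h1
    rw [le_div_iff₀ (by positivity)]
    simpa using h2
  have h5 : (2 : ℝ) ^ (32 * t * Real.logb 2 ((n : ℝ) / t) + 2 * t) * 4 ≤ 2 ^ (-t) * 2 ^ b := by
    rw [← Real.rpow_natCast 2 b, ← Real.rpow_add (by norm_num)]
    calc (2 : ℝ) ^ (32 * t * Real.logb 2 ((n : ℝ) / t) + 2 * t) * 4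
        ≤ 2 ^ (32 * t * Real.logb 2 ((n : ℝ) / t) + 2 * t) * 2 ^ (2 * t) := by
          gcongr
          exact four_le_two_rpow (by linarith)
      _ = 2 ^ (32 * t * Real.logb 2 ((n : ℝ) / t) + 4 * t) := by
          rw [← Real.rpow_add (by norm_num)]
          congr 1
          ring
      _ ≤ 2 ^ (-t + b) := by
          apply Real.rpow_le_rpow_of_exponent_le (by norm_num)
          nlinarith
  calc _ ≤ ∑ T ∈ C, (#{h : Finset (Fin n) → (Fin b → Bool) | h T = h X} : ℝ) := by
        exact_mod_cast hunion
    _ ≤ #C • (W / 2 ^ b) := sum_le_card_nsmul _ _ _ hone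
    _ = #C * (W / 2 ^ b) := nsmul_eq_mul _ _
    _ ≤ 2 ^ (32 * t * Real.logb 2 ((n : ℝ) / t) + 2 * t) * (W / 2 ^ b) := by gcongr
    _ = 2 ^ (32 * t * Real.logb 2 ((n : ℝ) / t) + 2 * t) * 4 * (W / 4 / 2 ^ b) := by ring
    _ ≤ 2 ^ (-t) * 2 ^ b * (W / 4 / 2 ^ b) := by gcongr
    _ = 2 ^ (-t) / 4 * W := by field_simp

/-- Bob's reconstruction: given the hash value `v` of the kept part of `x`, and the kept part `Y` of
`y`, a set that contains `Y`, exceeds it by at most `32 t` elements, and has the hash value `v`. -/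
noncomputable def hashCandidate {n b : ℕ} (t : ℝ) (h : Finset (Fin n) → (Fin b → Bool))
    (v : Fin b → Bool) (Y : Finset (Fin n)) : Finset (Fin n) :=
  open Classical in
  if hT : ∃ T, Y ⊆ T ∧ (#(T \ Y) : ℝ) ≤ 32 * t ∧ h T = v then hT.choose else ∅

theorem hashCandidate_eq {n b : ℕ} {t : ℝ} {h : Finset (Fin n) → (Fin b → Bool)}
    {X Y : Finset (Fin n)} (hYX : Y ⊆ X) (hXY : (#(X \ Y) : ℝ) ≤ 32 * t)
    (hcol : ¬ ∃ T, Y ⊆ T ∧ (#(T \ Y) : ℝ) ≤ 32 * t ∧ T ≠ X ∧ h T = h X) :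
    hashCandidate t h (h X) Y = X := by
  have hT : ∃ T, Y ⊆ T ∧ (#(T \ Y) : ℝ) ≤ 32 * t ∧ h T = h X := ⟨X, hYX, hXY, rfl⟩
  rw [hashCandidate, dif_pos hT]
  obtain ⟨h1, h2, h3⟩ := hT.choose_spec
  by_contra hne
  exact hcol ⟨_, h1, h2, hne, h3⟩

/-- The upper bound. Alice hashes the part of `x` that is kept at each of `O(log (n / t))` sampling
levels. Bob knows `‖x - y‖₀` and picks the level at which about `t` differences are expected; he
recovers these from the hash value. -/
theorem exists_sampling_protocol {n k : ℕ} {δ t : ℝ} (hk : 1 ≤ k) (hkt : (k : ℝ) ≤ t)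
    (htn : t ≤ (n : ℝ) / 2) (hδ : 2 ^ (-t) ≤ δ) :
    ∃ (s : ℕ) (π : PublicCoinProtocol (URSubset n k) s), π.Solves δ ∧
      (s : ℝ) ≤ 82 * (t * Real.logb 2 ((n : ℝ) / t) ^ 2) := by
  classical
  have hk1 : (1 : ℝ) ≤ k := by exact_mod_cast hk
  have ht : 1 ≤ t := hk1.trans hkt
  set ℓ := Real.logb 2 ((n : ℝ) / t) with hℓ
  have hℓ1 : 1 ≤ ℓ := one_le_logb_div ht htn
  set L := ⌊ℓ⌋₊ + 1 with hL
  set b := ⌈40 * t * ℓ⌉₊ with hb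
  have hb40 : 40 * t * ℓ ≤ b := Nat.le_ceil _
  have hlev : ∀ d : ℕ, ∃ r : Fin L, d ≤ n → ((d : ℝ) * (1 / 2) ^ (r : ℕ) ≤ 16 * t ∧
      ((r : ℕ) = 0 ∨ 8 * t ≤ (d : ℝ) * (1 / 2) ^ (r : ℕ))) := by
    intro d
    by_cases hd : d ≤ n
    · obtain ⟨r, hr, h1, h2⟩ := exists_level ht hd
      exact ⟨⟨r, Nat.lt_succ_of_le hr⟩, fun _ => ⟨h1, h2⟩⟩
    · exact ⟨0, fun h => absurd h hd⟩
  choose lev hlev using hlev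
  let Ω := (Fin n → Fin (2 ^ L)) × (Finset (Fin n) → (Fin b → Bool))
  let alice : Ω → (URSubset n k).AliceInput → (Fin (L * b) → Bool) := fun c x i =>
    c.2 (bitSupport x ∩ sampleLevel c.1 (finProdFinEquiv.symm i).1) (finProdFinEquiv.symm i).2
  let bob : Ω → (Fin (L * b) → Bool) → (URSubset n k).BobInput → (URSubset n k).Answer :=
    fun c μ yw =>
      let d := yw.2 - #(bitSupport yw.1)
      let Y := bitSupport yw.1 ∩ sampleLevel c.1 (lev d)
      truncateCard (min k d)
        (hashCandidate t c.2 (fun j => μ (finProdFinEquiv (lev d, j))) Y \ Y)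
  refine ⟨L * b, ⟨Ω, PMF.uniformOfFintype Ω, alice, bob⟩, ?_, ?_⟩
  · rintro x ⟨y, w⟩ ⟨hxy, hw⟩
    change bitSupport y ⊂ bitSupport x at hxy
    change w = #(bitSupport x) at hw
    set D := bitSupport x \ bitSupport y with hD
    have hdiff : diffSet x y = D := diffSet_eq_sdiff hxy.subset
    have hd : w - #(bitSupport y) = #D := by
      rw [hD, card_sdiff_of_subset hxy.subset, hw]
    have hDn : #D ≤ n := by simpa using card_le_univ D
    obtain ⟨hr16, hr8⟩ := hlev #D hDn
    set r := lev #D with hr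
    have hrL : (r : ℕ) ≤ L := r.2.le
    -- The coins for which too few or too many differences are kept, or the hash value is ambiguous.
    set B₁ : Finset (Fin n → Fin (2 ^ L)) :=
      {ω | ¬ min k #D ≤ #(D ∩ sampleLevel ω r)} with hB₁
    set B₂ : Finset (Fin n → Fin (2 ^ L)) := {ω | 32 * t < #(D ∩ sampleLevel ω r)} with hB₂
    set B₃ : (Fin n → Fin (2 ^ L)) → Finset (Finset (Fin n) → (Fin b → Bool)) := fun ω =>
      {h | ∃ T, bitSupport y ∩ sampleLevel ω r ⊆ T ∧
        (#(T \ (bitSupport y ∩ sampleLevel ω r)) : ℝ) ≤ 32 * t ∧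
        T ≠ bitSupport x ∩ sampleLevel ω r ∧ h T = h (bitSupport x ∩ sampleLevel ω r)} with hB₃
    have hsd : ∀ ω : Fin n → Fin (2 ^ L),
        (bitSupport x ∩ sampleLevel ω r) \ (bitSupport y ∩ sampleLevel ω r)
          = D ∩ sampleLevel ω r := by
      intro ω
      ext j
      simp only [hD, mem_sdiff, mem_inter]
      tauto
    have hc₁ : (#B₁ : ℝ) ≤ 2 ^ (-t) / 4 * Fintype.card (Fin n → Fin (2 ^ L)) := by
      rcases hr8 with h0 | h8
      · have : B₁ = ∅ := by
          rw [hB₁, filter_eq_empty_iff]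
          intro ω _
          rw [h0, sampleLevel_zero, inter_univ, not_not]
          exact min_le_right _ _
        rw [this, card_empty, Nat.cast_zero]
        positivity
      · refine le_trans ?_ (card_few_kept_le hrL ht hkt D h8)
        have : B₁ ⊆ univ.filter fun ω => #(D ∩ sampleLevel ω r) < k := by
          intro ω hω
          have h1 := (mem_filter.1 hω).2
          exact mem_filter.2 ⟨mem_univ _, lt_of_lt_of_le (not_le.1 h1) (min_le_left _ _)⟩
        exact_mod_cast card_le_card this
    have hc₂ : (#B₂ : ℝ) ≤ 2 ^ (-t) / 4 * Fintype.card (Fin n → Fin (2 ^ L)) :=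
      card_many_kept_le hrL ht D hr16
    have hc₃ : ∀ ω, (#(B₃ ω) : ℝ)
        ≤ 2 ^ (-t) / 4 * Fintype.card (Finset (Fin n) → (Fin b → Bool)) := fun ω =>
      card_collisions_le ht htn hb40 _ _
    let Bad : Finset Ω := ((B₁ ∪ B₂) ×ˢ univ) ∪
      ((univ : Finset (Σ _ : Fin n → Fin (2 ^ L), Finset (Fin n) → (Fin b → Bool))).filter
        fun z => z.2 ∈ B₃ z.1).image fun z => (z.1, z.2)
    refine failureProb_le_of_uniform alice bob x (y, w) Bad ?_ ?_
    · rintro ⟨ω, h⟩ hgood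
      have hgood' : (min k #D ≤ #(D ∩ sampleLevel ω r) ∧ ¬ 32 * t < #(D ∩ sampleLevel ω r)) ∧
          h ∉ B₃ ω := by
        refine ⟨⟨?_, fun hcon => ?_⟩, fun hh => ?_⟩
        · by_contra hcon
          exact hgood (mem_union_left _ (mem_product.2
            ⟨mem_union_left _ (mem_filter.2 ⟨mem_univ _, hcon⟩), mem_univ _⟩))
        · exact hgood (mem_union_left _ (mem_product.2
            ⟨mem_union_right _ (mem_filter.2 ⟨mem_univ _, hcon⟩), mem_univ _⟩))
        · exact hgood (mem_union_right _ (mem_image.2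
            ⟨⟨ω, h⟩, mem_filter.2 ⟨mem_univ _, hh⟩, rfl⟩))
      obtain ⟨⟨hg1, hg2⟩, hg3⟩ := hgood'
      have hcand : hashCandidate t h (h (bitSupport x ∩ sampleLevel ω r))
          (bitSupport y ∩ sampleLevel ω r) = bitSupport x ∩ sampleLevel ω r := by
        refine hashCandidate_eq (inter_subset_inter_right hxy.subset) ?_ ?_
        · rw [hsd]
          exact not_lt.1 hg2
        · exact fun hcon => hg3 (mem_filter.2 ⟨mem_univ _, hcon⟩)
      have hbob : bob (ω, h) (alice (ω, h) x) (y, w)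
          = truncateCard (min k #D) (D ∩ sampleLevel ω r) := by
        simp only [bob, alice, hd, Equiv.symm_apply_apply]
        rw [← hr, hcand, hsd]
      obtain ⟨h1, h2⟩ := truncateCard_spec hg1
      rw [hbob]
      change truncateCard (min k #D) (D ∩ sampleLevel ω r) ⊆ diffSet x y ∧
        #(truncateCard (min k #D) (D ∩ sampleLevel ω r)) = min k #(diffSet x y)
      rw [hdiff]
      exact ⟨h1.trans inter_subset_left, h2⟩
    · set W₁ : ℝ := (Fintype.card (Fin n → Fin (2 ^ L)) : ℝ) with hW₁
      set W₂ : ℝ := (Fintype.card (Finset (Fin n) → (Fin b → Bool)) : ℝ) with hW₂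
      have hW₁0 : 0 ≤ W₁ := Nat.cast_nonneg _
      have hW₂0 : 0 ≤ W₂ := Nat.cast_nonneg _
      have hΩ : (Fintype.card Ω : ℝ) = W₁ * W₂ := by
        rw [hW₁, hW₂, ← Nat.cast_mul, ← Fintype.card_prod]
      have h1 : (#((B₁ ∪ B₂) ×ˢ (univ : Finset (Finset (Fin n) → (Fin b → Bool)))) : ℝ)
          ≤ (2 ^ (-t) / 4 * W₁ + 2 ^ (-t) / 4 * W₁) * W₂ := by
        rw [card_product, card_univ]
        push_cast
        rw [← hW₂]
        gcongr
        have : (#(B₁ ∪ B₂) : ℝ) ≤ #B₁ + #B₂ := by exact_mod_cast card_union_le B₁ B₂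
        linarith
      have h2 : (#(((univ : Finset (Σ _ : Fin n → Fin (2 ^ L),
          Finset (Fin n) → (Fin b → Bool))).filter
          fun z => z.2 ∈ B₃ z.1).image fun z => (z.1, z.2)) : ℝ) ≤ W₁ * (2 ^ (-t) / 4 * W₂) := by
        have h3 : (univ : Finset (Σ _ : Fin n → Fin (2 ^ L),
            Finset (Fin n) → (Fin b → Bool))).filter (fun z => z.2 ∈ B₃ z.1)
            = univ.sigma fun ω => B₃ ω := by
          ext z
          simp
        rw [h3]
        calc _ ≤ ((#(univ.sigma fun ω => B₃ ω) : ℕ) : ℝ) := by exact_mod_cast card_image_le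
          _ = ∑ ω, (#(B₃ ω) : ℝ) := by rw [card_sigma]; push_cast; rfl
          _ ≤ #(univ : Finset (Fin n → Fin (2 ^ L))) • (2 ^ (-t) / 4 * W₂) :=
              sum_le_card_nsmul _ _ _ fun ω _ => hc₃ ω
          _ = W₁ * (2 ^ (-t) / 4 * W₂) := by rw [nsmul_eq_mul, card_univ]
      have h3 : (#Bad : ℝ) ≤ (2 ^ (-t) / 4 * W₁ + 2 ^ (-t) / 4 * W₁) * W₂
          + W₁ * (2 ^ (-t) / 4 * W₂) := by
        refine le_trans ?_ (add_le_add h1 h2)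
        exact_mod_cast card_union_le _ _
      rw [hΩ]
      calc (#Bad : ℝ) ≤ 3 / 4 * 2 ^ (-t) * (W₁ * W₂) := by linarith
        _ ≤ δ * (W₁ * W₂) := by
          gcongr
          have : (0 : ℝ) < 2 ^ (-t) := by positivity
          linarith
  · have hLl : (L : ℝ) ≤ 2 * ℓ := by
      have := Nat.floor_le (by linarith : 0 ≤ ℓ)
      rw [hL]
      push_cast
      linarith
    have htℓ : 1 ≤ t * ℓ := by nlinarith
    have hbl : (b : ℝ) ≤ 41 * (t * ℓ) := by
      have := (Nat.ceil_lt_add_one (by positivity : 0 ≤ 40 * t * ℓ)).le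
      rw [← hb] at this
      linarith
    push_cast
    calc (L : ℝ) * b ≤ 2 * ℓ * (41 * (t * ℓ)) := by gcongr
      _ = 82 * (t * ℓ ^ 2) := by ring

end UpperBound

theorem theorem1 (ε : ℝ) (hε : 0 < ε) :
    ∃ c C : ℝ, ∃ n₀ : ℕ, 0 < c ∧ 0 < C ∧
      ∀ (n k : ℕ) (δ : ℝ), 1 ≤ k → k ≤ n → 0 < δ → δ ≤ 1 - ε →
        (oneWayPubComplexity δ (URSubset n k) : ℝ)
            ≤ C * urRate n (max (k : ℝ) (Real.logb 2 (1 / δ))) ∧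
        (n₀ ≤ n →
          c * urRate n (max (k : ℝ) (Real.logb 2 (1 / δ)))
            ≤ (oneWayPubComplexity δ (URSubset n k) : ℝ)) := by
  set q₀ := max ⌈48 / min ε 1⌉₊ 18 with hq₀
  have hε1 : 0 < min ε 1 := lt_min hε one_pos
  refine ⟨min ε 1 / (16384 * 16 ^ q₀), 82, 8 * 16 ^ q₀, by positivity, by norm_num, ?_⟩
  intro n k δ hk hkn hδ0 hδ
  refine ⟨?_, fun hn => ?_⟩
  · have hle_n : (oneWayPubComplexity δ (URSubset n k) : ℝ) ≤ n := by
      exact_mod_cast Nat.sInf_le (exists_protocol_URSubset n k)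
    set t := max (k : ℝ) (Real.logb 2 (1 / δ)) with ht
    have hn0 : (0 : ℝ) ≤ n := Nat.cast_nonneg n
    rw [urRate]
    split_ifs with htn
    · have hδt : (2 : ℝ) ^ (-t) ≤ δ := by
        calc (2 : ℝ) ^ (-t) ≤ 2 ^ (-Real.logb 2 (1 / δ)) :=
              Real.rpow_le_rpow_of_exponent_le (by norm_num) (neg_le_neg (le_max_right _ _))
          _ = δ := by
              rw [Real.rpow_neg (by norm_num), Real.rpow_logb (by norm_num) (by norm_num)
                (by positivity), one_div, inv_inv]
      obtain ⟨s, π, hπ, hs⟩ := exists_sampling_protocol hk (le_max_left _ _) htn hδt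
      have hle_s : (oneWayPubComplexity δ (URSubset n k) : ℝ) ≤ s := by
        have hmem : s ∈ {s : ℕ | ∃ π : PublicCoinProtocol (URSubset n k) s, π.Solves δ} := ⟨π, hπ⟩
        exact_mod_cast Nat.sInf_le hmem
      rw [mul_min_of_nonneg _ _ (by norm_num)]
      exact le_min (by linarith) (hle_s.trans hs)
    · linarith
  · obtain ⟨π, hπ⟩ := Nat.sInf_mem (s := {s : ℕ | ∃ π : PublicCoinProtocol (URSubset n k) s,
      π.Solves δ}) ⟨n, exists_protocol_URSubset n k⟩
    refine lower_bound hε1 (min_le_right _ _) hδ0 ?_ hk π hπ ?_ (le_max_right _ _) hn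
    · linarith [min_le_left ε 1]
    · exact (Nat.le_ceil _).trans (by exact_mod_cast le_max_left _ _)
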